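/- Let $H$ be a (possibly unbounded) self-adjoint operator in a complex Hilbert space with domain $D(H)$, let $\mathfrak g>0$, and suppose that $H$ is of class $\mathcal C_{\mathfrak g}$: there is a family $\{P_n\}_{n\in I}$, $I\subset\mathbb N_0$, of mutually disjoint orthogonal projections ($P_nP_m=0$ for $n\neq m$) which is complete ($\sum_{n\in I}P_n=1$ strongly), such that every $P_n$ commutes with $H$ and the bands $\sigma_n:=\mathrm{spect}\big(P_nHP_n|_{\mathrm{Ran}\,P_n}\big)$ satisfy $\min\sigma_{n'}-\max\sigma_n\ge\mathfrak g$ (with both the minimum and the maximum existing) whenever $n'$ is the index following $n$ in $I$ ($n'=n+1$ if $I$ has no holes). Let $V$ be a bounded self-adjoint operator such that \[\|V\|_1:=\sup_{n,m\in I}\langle n-m\rangle\,\|P_nVP_m\|\le\frac{\mathfrak g}{8},\qquad \langle a\rangle:=\max(1,|a|).\] Then there exists a unitary operator $\mathcal U$ with $\mathcal U^{-1}D(H)\subset D(H)$ such that the operator $H_\infty:=\mathcal U(H+V)\mathcal U^{-1}$ has domain $D(H_\infty)=D(H)$ and commutes with all the projections: $[H_\infty,P_n]=0$ for every $n\in I$,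 i.e. $P_nD(H_\infty)\subset D(H_\infty)$ and $H_\infty P_n\psi=P_nH_\infty\psi$ for $\psi\in D(H_\infty)$. -/

import Mathlib

namespace BlockDiag

variable {E : Type*} [NormedAddCommGroup E] [InnerProductSpace ℂ E]

/-- The resolvent set of a (possibly unbounded) operator `T`: those `z` for which
`T - z : D(T) → E` is a bijection with a bounded everywhere defined inverse `R`. -/
def resolventSet (T : E →ₗ.[ℂ] E) : Set ℂ :=
  {z | ∃ R : E →L[ℂ] E,
    (∀ y : E, ∃ h : R y ∈ T.domain, T ⟨R y, h⟩ - z • R y = y) ∧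
    ∀ x : T.domain, R (T x - z • (x : E)) = x}

/-- The spectrum of a (possibly unbounded) operator. -/
def spectrum (T : E →ₗ.[ℂ] E) : Set ℂ := (resolventSet T)ᶜ

/-- The operator `P T P` restricted to the subspace `Ran P`, as an operator in `Ran P`, for an
idempotent `P`; its domain is `Ran P ∩ D(T)`. -/
def compression (T : E →ₗ.[ℂ] E) (P : E →L[ℂ] E) :
    (LinearMap.range P.toLinearMap) →ₗ.[ℂ] (LinearMap.range P.toLinearMap) where
  domain := T.domain.comap (LinearMap.range P.toLinearMap).subtype
  toFun :=
    { toFun := fun x => ⟨P (T ⟨((x : LinearMap.range P.toLinearMap) : E), x.2⟩),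
        LinearMap.mem_range_self P.toLinearMap _⟩
      map_add' := fun x y => Subtype.ext <| by
        have h := T.map_add ⟨((x : LinearMap.range P.toLinearMap) : E), x.2⟩
          ⟨((y : LinearMap.range P.toLinearMap) : E), y.2⟩
        exact (congrArg P h).trans (map_add P _ _)
      map_smul' := fun c x => Subtype.ext <| by
        have h := T.map_smul c ⟨((x : LinearMap.range P.toLinearMap) : E), x.2⟩
        exact (congrArg P h).trans (map_smul P _ _) }

/-- The band `σ = spect (P T P restricted to Ran P)`. It is only used for self-adjoint `T`
commuting with the orthogonal projection `P`, where the spectrum is real. -/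
def band (T : E →ₗ.[ℂ] E) (P : E →L[ℂ] E) : Set ℝ :=
  {t | (t : ℂ) ∈ spectrum (compression T P)}

/-- `[T, B] = 0` for a possibly unbounded `T` and a bounded `B`: `B` maps `D(T)` into itself and
`T B x = B T x` for all `x ∈ D(T)`. -/
def Commutes (T : E →ₗ.[ℂ] E) (B : E →L[ℂ] E) : Prop :=
  ∀ x : T.domain, ∃ h : B x ∈ T.domain, T ⟨B x, h⟩ = B (T x)

/-- The operator `U T U⁻¹` with its natural domain `{x | U⁻¹ x ∈ D(T)}`. -/
def conj (U : E ≃ₗᵢ[ℂ] E) (T : E →ₗ.[ℂ] E) : E →ₗ.[ℂ] E where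
  domain := T.domain.comap U.symm.toLinearEquiv.toLinearMap
  toFun :=
    { toFun := fun x => U (T ⟨U.symm x, x.2⟩)
      map_add' := fun x y => by
        have h : (⟨U.symm (x + y : E), (x + y).2⟩ : T.domain)
            = ⟨U.symm x, x.2⟩ + ⟨U.symm y, y.2⟩ := Subtype.ext (map_add U.symm _ _)
        exact (congrArg (fun z => U (T z)) h).trans (by rw [T.map_add, map_add])
      map_smul' := fun c x => by
        have h : (⟨U.symm (c • x : E), (c • x).2⟩ : T.domain)
            = c • ⟨U.symm x, x.2⟩ := Subtype.ext (map_smul U.symm _ _)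
        exact (congrArg (fun z => U (T z)) h).trans
          (by rw [T.map_smul, map_smul, RingHom.id_apply]) }

/-- `⟨a⟩ = max (1, |a|)`. -/
def bracket (a : ℝ) : ℝ := max 1 |a|

/-- `‖A‖_l = sup_{n, m ∈ I} ⟨n - m⟩ ^ l ‖P_n A P_m‖`, with values in `[0, ∞]`. -/
noncomputable def blockNorm {I : Set ℕ} (P : I → E →L[ℂ] E) (l : ℕ) (A : E →L[ℂ] E) : ENNReal :=
  ⨆ (n : I) (m : I), ENNReal.ofReal
    (bracket (((n : ℕ) : ℝ) - ((m : ℕ) : ℝ)) ^ l * ‖(P n).comp (A.comp (P m))‖)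

/-- The self-adjoint operator `H` is of class `𝒞_g`, as witnessed by the complete family of
mutually disjoint orthogonal projections `(P_n)_{n ∈ I}`, `I ⊆ ℕ`. Here `n ⋖ m` says that `m` is
the index in `I` that follows `n` (`m = n + 1` if `I` has no holes). -/
structure IsOfClass [CompleteSpace E] (g : ℝ) (H : E →ₗ.[ℂ] E) {I : Set ℕ}
    (P : I → E →L[ℂ] E) : Prop where
  pos : 0 < g
  selfAdjoint : IsSelfAdjoint H
  projection : ∀ n, IsStarProjection (P n)
  disjoint : ∀ n m, n ≠ m → (P n).comp (P m) = 0
  complete : ∀ x : E, HasSum (fun n => P n x) x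
  commutes : ∀ n, Commutes H (P n)
  gap : ∀ n m : I, n ⋖ m → ∃ a b : ℝ,
    IsGreatest (band H (P n)) a ∧ IsLeast (band H (P m)) b ∧ g ≤ b - a

end BlockDiag

-- Fix a cut `k`, put `P = ∑_{n<k} P_n` and `J = 1 - 2P`, and let `μ` be the midpoint of the gap of
-- `H` at the cut. Number the blocks by `c`, their rank in `I` relative to the cut. On block `c` the
-- form of `J (H - μ)` is at least `g |c + 1/2|`, because every gap passed adds `g`. The blocks of
-- `V` are at most `(g/8) / max 1 |c - c'|`. This kernel is unbounded on `ℓ²`, but it is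
-- form-bounded by the weight `|2c + 1|` (`schur_bound`), and the constants leave `Re J (H + V - μ)
-- ≥ g/32` (`cut_bound`).
--
-- A quantitative `tan 2Θ` argument (`norm_negProj_sub_sq_le`, `exists_spectral_cut`) turns this
-- into `‖F_k - P‖² ≤ (1 - κ)/2`, where `F_k` is the spectral projection of `H + V` below `μ` and `κ
-- = (g/32) / (g/32 + ‖V‖)`. The bound is below `1/2` uniformly in `k`. It is obtained for the
-- bounded operator `(H + V - μ)⁻¹`, so no unbounded functional calculus is needed.
--
-- The `F_k` commute, and closeness below `1/√2` to the increasing sums `P` forces them to increase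
-- to `1` (`exists_unitary_of_cuts`). With `q_n = F_{n+1} - F_n`, the operator `S = ∑ P_n q_n`
-- satisfies `S*S ≥ δ > 0` and has injective adjoint, so `U = S (S*S)^{-1/2}` is unitary and carries
-- `q_n` to `P_n` (`exists_unitary_of_resolutions`). Domains are preserved because `S` intertwines
-- `H + V` with `H` up to a bounded error and `(S*S)^{-1/2}` has a bounded commutator with `H + V`
-- (`exists_inverse_sqrt`).

open Filter Topology

namespace BlockDiag

-- Cayley transforms and a Lyapunov inequality.

section Bounded

variable {E : Type*} [NormedAddCommGroup E] [InnerProductSpace ℂ E]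

theorem re_inner_comm (x y : E) : (inner ℂ x y).re = (inner ℂ y x).re :=
  inner_re_symm (𝕜 := ℂ) x y

theorem re_inner_self (x : E) : (inner ℂ x x).re = ‖x‖ ^ 2 :=
  inner_self_eq_norm_sq (𝕜 := ℂ) x

theorem norm_add_sq_complex (x y : E) :
    ‖x + y‖ ^ 2 = ‖x‖ ^ 2 + 2 * (inner ℂ x y).re + ‖y‖ ^ 2 := norm_add_sq (𝕜 := ℂ) x y

theorem norm_sub_sq_complex (x y : E) :
    ‖x - y‖ ^ 2 = ‖x‖ ^ 2 - 2 * (inner ℂ x y).re + ‖y‖ ^ 2 := norm_sub_sq (𝕜 := ℂ) x y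

variable [CompleteSpace E]

theorem inner_apply_comm {A : E →L[ℂ] E} (hA : IsSelfAdjoint A) (x y : E) :
    inner ℂ (A x) y = inner ℂ x (A y) :=
  (ContinuousLinearMap.isSelfAdjoint_iff_isSymmetric.1 hA) x y

theorem nonneg_iff_re_inner {A : E →L[ℂ] E} :
    0 ≤ A ↔ IsSelfAdjoint A ∧ ∀ x, 0 ≤ (inner ℂ (A x) x).re := by
  rw [ContinuousLinearMap.nonneg_iff_isPositive, ContinuousLinearMap.isPositive_def']
  rfl

theorem denseRange_of_injective {B : E →L[ℂ] E} (hB : IsSelfAdjoint B)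
    (hinj : Function.Injective B) : DenseRange B := by
  have h : (LinearMap.range (B : E →ₗ[ℂ] E)).topologicalClosure = ⊤ := by
    rw [Submodule.topologicalClosure_eq_top_iff, Submodule.eq_bot_iff]
    intro x hx
    apply hinj
    rw [map_zero, ← inner_self_eq_zero (𝕜 := ℂ), inner_apply_comm hB,
      ← inner_apply_comm hB]
    rw [Submodule.mem_orthogonal'] at hx
    rw [inner_apply_comm hB]
    exact hx _ ⟨B x, rfl⟩
  have := Submodule.dense_iff_topologicalClosure_eq_top.2 h
  exact this

theorem isUnit_one_add_of_nonneg {B : E →L[ℂ] E} (hB : 0 ≤ B) : IsUnit (1 + B) := by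
  refine ContinuousLinearMap.isUnit_of_forall_le_norm_inner_map (1 + B) (c := 1) one_pos fun x => ?_
  refine le_trans ?_ (Complex.re_le_norm _)
  have h := (nonneg_iff_re_inner.1 hB).2 x
  have : (1 + B) x = x + B x := rfl
  rw [this, inner_add_left, Complex.add_re, re_inner_self]
  simp only [NNReal.coe_one, mul_one]
  linarith

/-- The Cayley transform `C = (1 - B)(1 + B)⁻¹` satisfies `‖z‖² - ‖C z‖² = 4 ⟨B D z, D z⟩`, so it is
a contraction and the decrements of `‖Cⁿ z‖²` tend to `0`. Hence `√B D Cⁿ z → 0`, then `Cⁿ (B D z) →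
0`, and the range of `B D` is dense. -/
theorem tendsto_cayley_pow {B D : E →L[ℂ] E} (hB : 0 ≤ B) (hinj : Function.Injective B)
    (hD : (1 + B) * D = 1) (hD' : D * (1 + B) = 1) (x : E) :
    Tendsto (fun n : ℕ => (((1 - B) * D) ^ n) x) atTop (𝓝 0) := by
  have hBs := (nonneg_iff_re_inner.1 hB).1
  have hcomm : Commute B D := by
    have h1 : D + B * D = 1 := by rw [← hD]; noncomm_ring
    have h2 : D + D * B = 1 := by rw [← hD']; noncomm_ring
    exact add_left_cancel (h1.trans h2.symm)
  set C := (1 - B) * D with hC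
  have hBC : Commute B C := ((Commute.one_right B).sub_right (Commute.refl B)).mul_right hcomm
  have hDC : Commute D C :=
    ((Commute.one_right D).sub_right hcomm.symm).mul_right (Commute.refl D)
  have key (z : E) : ‖z‖ ^ 2 - ‖C z‖ ^ 2 = 4 * (inner ℂ (B (D z)) (D z)).re := by
    have h1 : z = D z + B (D z) := by
      conv_lhs => rw [show z = ((1 + B) * D) z by rw [hD]; rfl]
      rfl
    have h2 : C z = D z - B (D z) := rfl
    rw [h2]
    nth_rewrite 1 [h1]
    rw [norm_add_sq_complex, norm_sub_sq_complex, re_inner_comm]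
    ring
  have hCle (z : E) : ‖C z‖ ≤ ‖z‖ := by
    have := key z
    have h2 := (nonneg_iff_re_inner.1 hB).2 (D z)
    exact le_of_sq_le_sq (by linarith) (norm_nonneg z)
  have hCn (n : ℕ) (z : E) : ‖(C ^ n) z‖ ≤ ‖z‖ := by
    induction n with
    | zero => simp
    | succ n ih => rw [pow_succ']; exact (hCle _).trans ih
  have hsq := CFC.sqrt_mul_sqrt_self B hB
  have hsq0 := CFC.sqrt_nonneg B
  set S := CFC.sqrt B
  have hSs := (nonneg_iff_re_inner.1 hsq0).1
  have hS (y : E) : (inner ℂ (B y) y).re = ‖S y‖ ^ 2 := by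
    rw [← hsq, ← re_inner_self, mul_apply_eq_comp, inner_apply_comm hSs]
  have hBDz (z : E) : Tendsto (fun n : ℕ => B (D ((C ^ n) z))) atTop (𝓝 0) := by
    have hanti : Antitone fun n : ℕ => ‖(C ^ n) z‖ ^ 2 := by
      refine antitone_nat_of_succ_le fun n => ?_
      rw [pow_succ' C]
      exact pow_le_pow_left₀ (norm_nonneg _) (hCle _) 2
    have hlim := tendsto_atTop_ciInf hanti ⟨0, by rintro _ ⟨n, rfl⟩; positivity⟩
    have hdiff := hlim.sub (hlim.comp (tendsto_add_atTop_nat 1))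
    rw [sub_self] at hdiff
    have h0 : Tendsto (fun n : ℕ => ‖S (D ((C ^ n) z))‖ ^ 2) atTop (𝓝 0) := by
      have := hdiff.const_mul (1 / 4 : ℝ)
      rw [mul_zero] at this
      refine this.congr fun n => ?_
      have hk := key ((C ^ n) z)
      rw [hS] at hk
      simp only [Function.comp, pow_succ' C, mul_apply_eq_comp]
      linarith
    have h1 : Tendsto (fun n : ℕ => ‖S (D ((C ^ n) z))‖) atTop (𝓝 0) := by
      have := h0.sqrt
      simpa [Real.sqrt_sq] using this
    have h2 := (tendsto_zero_iff_norm_tendsto_zero.2 h1)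
    have h3 := (S.continuous.tendsto 0).comp h2
    rw [map_zero] at h3
    refine h3.congr fun n => ?_
    rw [← hsq]; rfl
  have hdense : DenseRange (fun z => B (D z)) := by
    have hDs : Function.Surjective D := fun y => ⟨(1 + B) y, by
      rw [← mul_apply_eq_comp, hD']; rfl⟩
    have := (denseRange_of_injective hBs hinj)
    unfold DenseRange at *
    rwa [show (fun z => B (D z)) = B ∘ D from rfl, hDs.range_comp]
  rw [Metric.tendsto_atTop]
  intro ε hε
  obtain ⟨z, hz⟩ := hdense.exists_dist_lt x (half_pos hε)
  have := hBDz z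
  rw [Metric.tendsto_atTop] at this
  obtain ⟨N, hN⟩ := this (ε / 2) (half_pos hε)
  refine ⟨N, fun n hn => ?_⟩
  have h1 := hN n hn
  have h2 : B (D ((C ^ n) z)) = (C ^ n) (B (D z)) := by
    have : (B * D) * C ^ n = C ^ n * (B * D) := ((hBC.mul_left hDC).pow_right n)
    exact congrArg (fun T : E →L[ℂ] E => T z) this
  rw [h2] at h1
  rw [dist_zero_right] at h1 ⊢
  have h3 := hCn n (x - B (D z))
  rw [map_sub] at h3
  rw [dist_eq_norm] at hz
  have h4 := norm_add_le ((C ^ n) x - (C ^ n) (B (D z))) ((C ^ n) (B (D z)))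
  rw [sub_add_cancel] at h4
  linarith

/-- A Lyapunov inequality: `A B + B A ≥ 0` with `B ≥ 0` injective forces `A ≥ 0`. -/
theorem re_inner_nonneg_of_lyapunov {A B : E →L[ℂ] E} (hA : IsSelfAdjoint A) (hB : 0 ≤ B)
    (hinj : Function.Injective B) (h : ∀ x, 0 ≤ (inner ℂ (A x) (B x)).re) (x : E) :
    0 ≤ (inner ℂ (A x) x).re := by
  obtain ⟨u, hu⟩ := isUnit_one_add_of_nonneg hB
  have hD : (1 + B) * (↑u⁻¹ : E →L[ℂ] E) = 1 := by rw [← hu]; exact u.mul_inv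
  have hD' : (↑u⁻¹ : E →L[ℂ] E) * (1 + B) = 1 := by rw [← hu]; exact u.inv_mul
  set D : E →L[ℂ] E := ↑u⁻¹
  set C := (1 - B) * D with hC
  -- The two sides differ by `4 Re ⟨A y, B y⟩`. With `y = D z` the form of `A` therefore decreases
  -- along the orbit of `C`, which tends to `0`.
  have haux (y : E) : (inner ℂ (A (y - B y)) (y - B y)).re ≤
      (inner ℂ (A (y + B y)) (y + B y)).re := by
    have h3 := h y
    have h4 : (inner ℂ (A (B y)) y).re = (inner ℂ (A y) (B y)).re := by
      rw [inner_apply_comm hA, re_inner_comm]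
    simp only [map_add, map_sub, inner_add_left, inner_add_right, inner_sub_left, inner_sub_right,
      Complex.add_re, Complex.sub_re]
    linarith
  have hstep (z : E) : (inner ℂ (A (C z)) (C z)).re ≤ (inner ℂ (A z) z).re := by
    have h1 : D z + B (D z) = z := by
      conv_rhs => rw [show z = ((1 + B) * D) z by rw [hD]; rfl]
      rfl
    have h2 := haux (D z)
    rwa [h1] at h2
  have hle (n : ℕ) : (inner ℂ (A ((C ^ n) x)) ((C ^ n) x)).re ≤ (inner ℂ (A x) x).re := by
    induction n with
    | zero => simp
    | succ n ih => rw [pow_succ']; exact (hstep _).trans ih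
  have ht := tendsto_cayley_pow hB hinj hD hD' x
  have hcont : Continuous fun z : E => (inner ℂ (A z) z).re := by fun_prop
  have := (hcont.tendsto 0).comp ht
  simp only [map_zero, inner_zero_left, Complex.zero_re] at this
  exact le_of_tendsto this (Eventually.of_forall hle)

end Bounded

-- The sign of a bounded self-adjoint operator and the `tan 2Θ` estimate.

section Sign

variable {E : Type*} [NormedAddCommGroup E] [InnerProductSpace ℂ E] [CompleteSpace E]

theorem norm_abs_apply {R : E →L[ℂ] E} (hR : IsSelfAdjoint R) (x : E) :
    ‖CFC.abs R x‖ = ‖R x‖ := by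
  have h0 := (nonneg_iff_re_inner.1 (CFC.abs_nonneg R)).1
  have h1 : CFC.abs R * CFC.abs R = R * R := by rw [CFC.abs_mul_abs, hR.star_eq]
  have h2 : CFC.abs R (CFC.abs R x) = R (R x) := congrArg (fun T : E →L[ℂ] E => T x) h1
  rw [← sq_eq_sq₀ (norm_nonneg _) (norm_nonneg _), ← re_inner_self, ← re_inner_self,
    inner_apply_comm h0, h2, inner_apply_comm hR]

/-- The spectral projection of an injective self-adjoint `R` onto its negative part. -/
noncomputable def negProj (R : E →L[ℂ] E) : E →L[ℂ] E :=
  1 - (LinearMap.ker (CFC.abs R - R : E →L[ℂ] E).toLinearMap).starProjection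

theorem mem_ker_abs_sub {R : E →L[ℂ] E} {x : E} :
    x ∈ LinearMap.ker (CFC.abs R - R : E →L[ℂ] E).toLinearMap ↔ CFC.abs R x = R x := by
  rw [LinearMap.mem_ker]
  exact sub_eq_zero

theorem isStarProjection_negProj (R : E →L[ℂ] E) : IsStarProjection (negProj R) :=
  isStarProjection_starProjection.one_sub

theorem commute_starProjection_of_invariant {K : Submodule ℂ E} [K.HasOrthogonalProjection]
    {B : E →L[ℂ] E} (hB : IsSelfAdjoint B) (h : ∀ x ∈ K, B x ∈ K) :
    Commute K.starProjection B := by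
  rw [ContinuousLinearMap.IsIdempotentElem.commute_iff K.isIdempotentElem_starProjection,
    Submodule.range_starProjection, Submodule.ker_starProjection]
  refine ⟨h, fun x hx => ?_⟩
  rw [Submodule.mem_orthogonal] at hx
  change B x ∈ Kᗮ
  rw [Submodule.mem_orthogonal]
  intro u hu
  rw [← inner_apply_comm hB]
  exact hx _ (h u hu)

theorem commute_negProj {R B : E →L[ℂ] E} (hB : IsSelfAdjoint B)
    (h : Commute R B) : Commute (negProj R) B := by
  refine (Commute.one_left B).sub_left (commute_starProjection_of_invariant hB fun x hx => ?_)
  have h1 : Commute (CFC.abs R) B := h.cfcAbs_left (by rwa [hB.star_eq])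
  rw [mem_ker_abs_sub] at hx ⊢
  have e1 : CFC.abs R (B x) = B (CFC.abs R x) := congrArg (fun T : E →L[ℂ] E => T x) h1
  have e2 : R (B x) = B (R x) := congrArg (fun T : E →L[ℂ] E => T x) h
  rw [e1, e2, hx]

/-- The polar decomposition `R = |R| (1 - 2F)`. Since `|R|² = R²`, the operator `|R| + R` maps into
`ker (|R| - R)`; being self-adjoint, it vanishes on the orthogonal complement of that kernel. -/
theorem abs_reflection_apply {R : E →L[ℂ] E} (hR : IsSelfAdjoint R) (x : E) :
    CFC.abs R (x - (2 : ℂ) • negProj R x) = R x := by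
  set K := LinearMap.ker (CFC.abs R - R : E →L[ℂ] E).toLinearMap
  have h0 := (nonneg_iff_re_inner.1 (CFC.abs_nonneg R)).1
  have h1 : CFC.abs R * CFC.abs R = R * R := by rw [CFC.abs_mul_abs, hR.star_eq]
  have hc : Commute (CFC.abs R) R := CFC.commute_abs_self R hR.isStarNormal
  set p := K.starProjection x with hp
  have e1 : CFC.abs R p = R p := mem_ker_abs_sub.1 (K.starProjection_apply_mem x)
  have e2 : CFC.abs R (x - p) + R (x - p) = 0 := by
    refine ext_inner_right ℂ fun z => ?_
    rw [inner_add_left, inner_apply_comm h0, inner_apply_comm hR, ← inner_add_right,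
      inner_zero_left]
    refine K.starProjection_inner_eq_zero x _ (mem_ker_abs_sub.2 ?_)
    rw [map_add, map_add]
    have e3 : CFC.abs R (CFC.abs R z) = R (R z) := congrArg (fun T : E →L[ℂ] E => T z) h1
    have e4 : CFC.abs R (R z) = R (CFC.abs R z) := congrArg (fun T : E →L[ℂ] E => T z) hc
    rw [e3, e4, add_comm]
  have e5 : negProj R x = x - p := rfl
  have e6 : x - (2 : ℂ) • (x - p) = p - (x - p) := by
    rw [two_smul]; abel
  rw [e5, e6, map_sub, e1, eq_neg_of_add_eq_zero_left e2, sub_neg_eq_add, ← map_add]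
  congr 1
  abel

/-- A quantitative `tan 2Θ` estimate. If the reflection `1 - 2P` and the self-adjoint injective
operator `R` satisfy `Re (1 - 2P) R ≥ 0` and `‖R x‖ ≤ κ⁻¹ ‖Re ((1 - 2P) R) x‖`, then `P` is
close to the negative spectral projection of `R`. -/
theorem norm_negProj_sub_sq_le {R P : E →L[ℂ] E} (hR : IsSelfAdjoint R)
    (hinj : Function.Injective R) (hP : IsStarProjection P) {κ : ℝ} (hκ : 0 ≤ κ)
    (hpos : ∀ x, 0 ≤ (inner ℂ (((1 - (2 : ℂ) • P) * R) x) x).re)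
    (hnorm : ∀ x, 2 * κ * ‖R x‖ ≤ ‖((1 - (2 : ℂ) • P) * R + R * (1 - (2 : ℂ) • P)) x‖) (x : E) :
    ‖negProj R x - P x‖ ^ 2 ≤ (1 - κ) / 2 * ‖x‖ ^ 2 := by
  set J₀ : E →L[ℂ] E := 1 - (2 : ℂ) • P with hJ₀
  have h2 : IsSelfAdjoint (2 : ℂ) := by simp [IsSelfAdjoint]
  have hJ₀s : IsSelfAdjoint J₀ := (IsSelfAdjoint.one _).sub (h2.smul hP.isSelfAdjoint)
  set F := negProj R with hF
  have hFp := isStarProjection_negProj R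
  set J : E →L[ℂ] E := 1 - (2 : ℂ) • F with hJ
  have hJs : IsSelfAdjoint J := (IsSelfAdjoint.one _).sub (h2.smul hFp.isSelfAdjoint)
  have hsq (Q : E →L[ℂ] E) (hQ : IsStarProjection Q) :
      (1 - (2 : ℂ) • Q) * (1 - (2 : ℂ) • Q) = 1 := by
    have := hQ.isIdempotentElem.eq
    simp only [sub_mul, mul_sub, one_mul, mul_one, smul_mul_assoc, mul_smul_comm, this]
    module
  set B := CFC.abs R with hBdef
  have hB0 : 0 ≤ B := CFC.abs_nonneg R
  have hBs := (nonneg_iff_re_inner.1 hB0).1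
  have hBJ (y : E) : B (J y) = R y := abs_reflection_apply hR y
  have hJJ (y : E) : J (J y) = y := congrArg (fun T : E →L[ℂ] E => T y) (hsq F hFp)
  have hRJ (y : E) : R (J y) = B y := by rw [← hBJ, hJJ]
  have hJR : Commute J R := by
    refine (Commute.one_left R).sub_left ((commute_negProj hR (Commute.refl R)).smul_left _)
  have hJR' (y : E) : J (R y) = B y := by
    rw [← hRJ]; exact congrArg (fun T : E →L[ℂ] E => T y) hJR
  -- `Re (J₀ R) ≥ κ |R|`
  set N₂ : E →L[ℂ] E := J₀ * R + R * J₀ with hN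
  have hN₂s : IsSelfAdjoint N₂ := by
    rw [hN, IsSelfAdjoint, star_add, star_mul, star_mul, hR.star_eq, hJ₀s.star_eq, add_comm]
  have hN₂re (y : E) : (inner ℂ (N₂ y) y).re = 2 * (inner ℂ (J₀ y) (R y)).re := by
    have : N₂ y = J₀ (R y) + R (J₀ y) := rfl
    rw [this, inner_add_left, Complex.add_re, inner_apply_comm hJ₀s, inner_apply_comm hR (J₀ y),
      re_inner_comm (R y)]
    ring
  have hN₂0 : 0 ≤ N₂ := by
    refine nonneg_iff_re_inner.2 ⟨hN₂s, fun y => ?_⟩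
    rw [hN₂re]
    have := hpos y
    rw [mul_apply_eq_comp, inner_apply_comm hJ₀s, re_inner_comm] at this
    linarith
  -- The norm hypothesis says `(2κ|R|)² ≤ N₂²`; operator monotonicity of the square root removes the
  -- squares.
  have hle : ((2 * κ : ℝ) : ℂ) • B ≤ N₂ := by
    have hκs : IsSelfAdjoint ((2 * κ : ℝ) : ℂ) := Complex.conj_ofReal _
    have hκB : 0 ≤ ((2 * κ : ℝ) : ℂ) • B := by
      refine nonneg_iff_re_inner.2 ⟨hκs.smul hBs, fun y => ?_⟩
      rw [smul_apply, inner_smul_left, Complex.conj_ofReal,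
        Complex.re_ofReal_mul]
      exact mul_nonneg (by positivity) ((nonneg_iff_re_inner.1 hB0).2 y)
    rw [← CFC.sqrt_mul_self (((2 * κ : ℝ) : ℂ) • B) hκB, ← CFC.sqrt_mul_self N₂ hN₂0]
    apply CFC.sqrt_le_sqrt
    rw [← sub_nonneg]
    refine nonneg_iff_re_inner.2 ⟨?_, fun y => ?_⟩
    · refine IsSelfAdjoint.sub ?_ ?_
      · rw [IsSelfAdjoint, star_mul, hN₂s.star_eq]
      · rw [IsSelfAdjoint, star_mul, (hκs.smul hBs).star_eq]
    · rw [sub_apply, inner_sub_left, mul_apply_eq_comp, mul_apply_eq_comp,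
        inner_apply_comm hN₂s, inner_apply_comm (hκs.smul hBs), Complex.sub_re, re_inner_self,
        re_inner_self, smul_apply, norm_smul, norm_abs_apply hR,
        sub_nonneg, Complex.norm_real, Real.norm_of_nonneg (by positivity)]
      exact pow_le_pow_left₀ (by positivity) (hnorm y) 2
  have hκle (y : E) : κ * (inner ℂ y (B y)).re ≤ (inner ℂ (J₀ y) (R y)).re := by
    have := (nonneg_iff_re_inner.1 (sub_nonneg.2 hle)).2 y
    rw [sub_apply, inner_sub_left, Complex.sub_re, hN₂re,
      smul_apply, inner_smul_left, Complex.conj_ofReal,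
      Complex.re_ofReal_mul, re_inner_comm (B y)] at this
    linarith
  -- The Lyapunov inequality is applied with `|R|` as the positive operator. Since `|R| J = R`, the
  -- form `Re ⟨A y, |R| y⟩` splits into the inequality `hκle` at `y` and at `J y`. The outcome `A ≥
  -- 0` means `Re ⟨J₀ x, J x⟩ ≥ κ ‖x‖²`.
  set A : E →L[ℂ] E := J₀ * J + J * J₀ - ((2 * κ : ℝ) : ℂ) • (1 : E →L[ℂ] E) with hA
  have hAs : IsSelfAdjoint A := by
    have hκs : IsSelfAdjoint ((2 * κ : ℝ) : ℂ) := Complex.conj_ofReal _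
    refine IsSelfAdjoint.sub ?_ (hκs.smul (IsSelfAdjoint.one _))
    rw [IsSelfAdjoint, star_add, star_mul, star_mul, hJs.star_eq, hJ₀s.star_eq, add_comm]
  have hAapp (y : E) : A y = J₀ (J y) + J (J₀ y) - ((2 * κ : ℝ) : ℂ) • y := rfl
  have hBinj : Function.Injective B := fun y z hyz => by
    have : R (J y) = R (J z) := by rw [hRJ, hRJ, hyz]
    rw [← hJJ y, hinj this, hJJ]
  have hfin := re_inner_nonneg_of_lyapunov hAs hB0 hBinj (fun y => by
    rw [hAapp, inner_sub_left, inner_add_left, inner_smul_left, Complex.conj_ofReal,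
      Complex.sub_re, Complex.add_re, Complex.re_ofReal_mul]
    have e1 := hκle (J y)
    rw [hBJ, hRJ, inner_apply_comm hJs, hJR'] at e1
    have e2 := hκle y
    have e3 : J (B y) = R y := by rw [← hJR', hJJ]
    rw [inner_apply_comm hJs (J₀ y), e3]
    linarith) x
  rw [hAapp, inner_sub_left, inner_add_left, inner_smul_left, Complex.conj_ofReal,
      Complex.sub_re, Complex.add_re, Complex.re_ofReal_mul, inner_apply_comm hJs,
      inner_apply_comm hJ₀s, re_inner_comm (J x), re_inner_self] at hfin
  have e1 : F x - P x = (1 / 2 : ℂ) • (J₀ x - J x) := by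
    have a1 : J₀ x = x - (2 : ℂ) • P x := rfl
    have a2 : J x = x - (2 : ℂ) • F x := rfl
    rw [a1, a2]
    module
  have hiso (T : E →L[ℂ] E) (hT : IsSelfAdjoint T) (hTT : T * T = 1) : ‖T x‖ ^ 2 = ‖x‖ ^ 2 := by
    rw [← re_inner_self, inner_apply_comm hT, ← mul_apply_eq_comp, hTT, ← re_inner_self]
    rfl
  rw [e1, norm_smul, mul_pow, norm_sub_sq_complex, hiso J hJs (hsq F hFp),
    hiso J₀ hJ₀s (hsq P hP)]
  norm_num
  linarith

end Sign

-- Self-adjoint graphs, their bounded perturbations, and spectral cuts.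

section Relation

variable {E : Type*} [NormedAddCommGroup E] [InnerProductSpace ℂ E]

/-- The graph of `T + V`, given the graph `G` of `T`. -/
def perturb (G : Submodule ℂ (E × E)) (V : E →L[ℂ] E) : Submodule ℂ (E × E) :=
  G.comap ((LinearMap.fst ℂ E E).prod
    (LinearMap.snd ℂ E E - V.toLinearMap ∘ₗ LinearMap.fst ℂ E E))

theorem mem_perturb {G : Submodule ℂ (E × E)} {V : E →L[ℂ] E} {x y : E} :
    (x, y) ∈ perturb G V ↔ (x, y - V x) ∈ G := Iff.rfl

/-- A bounded operator commutes with the operator whose graph is `G`. -/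
def PreservesGraph (G : Submodule ℂ (E × E)) (B : E →L[ℂ] E) : Prop :=
  ∀ x y, (x, y) ∈ G → (B x, B y) ∈ G

theorem inner_eq_of_mem {G : Submodule ℂ (E × E)} (hG : G.adjoint = G) {x y a b : E}
    (h : (x, y) ∈ G) (h' : (a, b) ∈ G) : inner ℂ b x = inner ℂ a y := by
  rw [← hG, Submodule.mem_adjoint_iff] at h
  exact sub_eq_zero.1 (h a b h')

theorem mem_of_inner_eq {G : Submodule ℂ (E × E)} (hG : G.adjoint = G) {x y : E}
    (h : ∀ a b, (a, b) ∈ G → inner ℂ b x = inner ℂ a y) : (x, y) ∈ G := by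
  rw [← hG, Submodule.mem_adjoint_iff]
  exact fun a b hab => sub_eq_zero.2 (h a b hab)

theorem mem_of_tendsto_graph {G : Submodule ℂ (E × E)} (hG : G.adjoint = G) {x y : E}
    {u v : ℕ → E} (h : ∀ n, (u n, v n) ∈ G) (hu : Tendsto u atTop (𝓝 x))
    (hv : Tendsto v atTop (𝓝 y)) : (x, y) ∈ G := by
  refine mem_of_inner_eq hG fun a b hab => ?_
  have h1 : Tendsto (fun n => inner ℂ b (u n)) atTop (𝓝 (inner ℂ b x)) :=
    tendsto_const_nhds.inner hu
  have h2 : Tendsto (fun n => inner ℂ a (v n)) atTop (𝓝 (inner ℂ a y)) :=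
    tendsto_const_nhds.inner hv
  exact tendsto_nhds_unique (h1.congr fun n => inner_eq_of_mem hG (h n) hab) h2

theorem isClosed_of_adjoint_eq {G : Submodule ℂ (E × E)} (hG : G.adjoint = G) :
    IsClosed (G : Set (E × E)) := by
  refine IsSeqClosed.isClosed fun u p hu hp => ?_
  exact mem_of_tendsto_graph hG (x := p.1) (y := p.2) hu
    ((continuous_fst.tendsto p).comp hp) ((continuous_snd.tendsto p).comp hp)

variable [CompleteSpace E]

theorem adjoint_perturb {G : Submodule ℂ (E × E)} (hG : G.adjoint = G) {V : E →L[ℂ] E}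
    (hV : IsSelfAdjoint V) : (perturb G V).adjoint = perturb G V := by
  ext ⟨x, y⟩
  rw [Submodule.mem_adjoint_iff, mem_perturb]
  constructor
  · intro h
    refine mem_of_inner_eq hG fun a b hab => ?_
    have := sub_eq_zero.1 (h a (b + V a) (by rwa [mem_perturb, add_sub_cancel_right]))
    simp only [inner_add_left] at this
    rw [inner_sub_right, ← inner_apply_comm hV, ← this, add_sub_cancel_right]
  · intro h a b hab
    have := inner_eq_of_mem hG h (mem_perturb.1 hab)
    rw [inner_sub_left, inner_sub_right, inner_apply_comm hV] at this
    rw [sub_eq_zero]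
    exact sub_left_injective this

/-- The lower bound and closedness of `G` make the range closed; a vector orthogonal to the range
lies in the kernel by self-adjointness, hence is `0`. Single-valuedness of `G` becomes injectivity
of the inverse. -/
theorem exists_inverse_of_bound {G : Submodule ℂ (E × E)} (hG : G.adjoint = G) {c : ℝ}
    (hc : 0 < c) (h : ∀ x y, (x, y) ∈ G → c * ‖x‖ ≤ ‖y‖) (hsv : ∀ y, (0, y) ∈ G → y = 0) :
    ∃ R : E →L[ℂ] E, IsSelfAdjoint R ∧ Function.Injective R ∧
      ∀ x y, (x, y) ∈ G ↔ x = R y := by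
  have hclosed : IsClosed ((G.map (LinearMap.snd ℂ E E) : Submodule ℂ E) : Set E) := by
    have : CompleteSpace G := (isClosed_of_adjoint_eq hG).completeSpace_coe
    let f : G →L[ℂ] E := (ContinuousLinearMap.snd ℂ E E).comp G.subtypeL
    have hf : AntilipschitzWith (Real.toNNReal (max 1 c⁻¹)) f := by
      refine AddMonoidHomClass.antilipschitz_of_bound f fun p => ?_
      rw [Real.coe_toNNReal _ (by positivity)]
      have h1 := h p.1.1 p.1.2 p.2
      have h2 : ‖p‖ = max ‖p.1.1‖ ‖p.1.2‖ := rfl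
      have h3 : f p = p.1.2 := rfl
      rw [h2, h3, max_le_iff]
      constructor
      · calc ‖p.1.1‖ = c⁻¹ * (c * ‖p.1.1‖) := by field_simp
          _ ≤ c⁻¹ * ‖p.1.2‖ := by gcongr
          _ ≤ _ := by gcongr; exact le_max_right _ _
      · calc ‖p.1.2‖ = 1 * ‖p.1.2‖ := (one_mul _).symm
          _ ≤ _ := by gcongr; exact le_max_left _ _
    have := hf.isClosed_range f.uniformContinuous
    convert this using 1
    ext y
    simp only [Submodule.map_coe, Set.mem_image, Set.mem_range]
    constructor
    · rintro ⟨p, hp, rfl⟩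
      exact ⟨⟨p, hp⟩, rfl⟩
    · rintro ⟨p, rfl⟩
      exact ⟨p, p.2, rfl⟩
  have htop : G.map (LinearMap.snd ℂ E E) = ⊤ := by
    rw [← hclosed.submodule_topologicalClosure_eq, Submodule.topologicalClosure_eq_top_iff,
      Submodule.eq_bot_iff]
    intro z hz
    rw [Submodule.mem_orthogonal] at hz
    have : (z, (0 : E)) ∈ G := by
      refine mem_of_inner_eq hG fun a b hab => ?_
      rw [inner_zero_right]
      exact hz b ⟨(a, b), hab, rfl⟩
    have h1 := h _ _ this
    rw [norm_zero] at h1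
    have : ‖z‖ ≤ 0 := by
      by_contra hneg
      exact absurd h1 (not_le.2 (mul_pos hc (not_le.1 hneg)))
    exact norm_le_zero_iff.1 this
  have hex (y : E) : ∃ x, (x, y) ∈ G := by
    obtain ⟨p, hp, rfl⟩ := (Submodule.eq_top_iff'.1 htop) y
    exact ⟨p.1, hp⟩
  choose f hf using hex
  have huniq (x x' y : E) (h1 : (x, y) ∈ G) (h2 : (x', y) ∈ G) : x = x' := by
    have h3 := h _ _ (G.sub_mem h1 h2)
    simp only [sub_self, norm_zero] at h3
    have : ‖x - x'‖ ≤ 0 := by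
      by_contra hneg
      exact absurd h3 (not_le.2 (mul_pos hc (not_le.1 hneg)))
    exact sub_eq_zero.1 (norm_le_zero_iff.1 this)
  let R : E →L[ℂ] E := LinearMap.mkContinuous
    { toFun := f
      map_add' := fun y z => huniq _ _ _ (hf _) (G.add_mem (hf y) (hf z))
      map_smul' := fun k y => huniq _ _ _ (hf _) (G.smul_mem k (hf y)) } c⁻¹ (fun y => by
        have h1 := h _ _ (hf y)
        calc ‖f y‖ = c⁻¹ * (c * ‖f y‖) := by field_simp
          _ ≤ c⁻¹ * ‖y‖ := by gcongr)
  have hR (y : E) : (R y, y) ∈ G := hf y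
  refine ⟨R, ?_, fun y z hyz => ?_, fun x y => ⟨fun hxy => huniq _ _ _ hxy (hR y), ?_⟩⟩
  · rw [ContinuousLinearMap.isSelfAdjoint_iff_isSymmetric]
    exact fun x y => (inner_eq_of_mem hG (hR y) (hR x)).symm
  · have h1 : ((0 : E), y - z) ∈ G := by
      have := G.sub_mem (hR y) (hR z)
      rwa [Prod.mk_sub_mk, hyz, sub_self] at this
    exact sub_eq_zero.1 (hsv _ h1)
  · rintro rfl
    exact hR y

theorem norm_one_sub_two_smul_apply {P : E →L[ℂ] E} (hP : IsStarProjection P) (x : E) :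
    ‖x - (2 : ℂ) • P x‖ = ‖x‖ := by
  have h : P (P x) = P x := congrArg (fun T : E →L[ℂ] E => T x) hP.isIdempotentElem.eq
  have h1 : (inner ℂ x ((2 : ℂ) • P x)).re = 2 * ‖P x‖ ^ 2 := by
    rw [inner_smul_right, show (2 : ℂ) = ((2 : ℝ) : ℂ) by norm_num, Complex.re_ofReal_mul,
      ← re_inner_self, inner_apply_comm hP.isSelfAdjoint, h]
  rw [← sq_eq_sq₀ (norm_nonneg _) (norm_nonneg _), norm_sub_sq_complex, h1, norm_smul, mul_pow]
  norm_num
  ring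

theorem norm_apply_le_of_isStarProjection {P : E →L[ℂ] E} (hP : IsStarProjection P) (x : E) :
    ‖P x‖ ≤ ‖x‖ := by
  simpa using P.le_of_opNorm_le (IsStarProjection.norm_le P hP) x

/-- Let `T` be self-adjoint with `Re (1 - 2P) (T + V - μ) ≥ c > 0` for a projection `P` commuting
with `T`. Then there is a spectral projection of `T + V` (below `μ`) close to `P`. -/
theorem exists_spectral_cut {G : Submodule ℂ (E × E)} (hG : G.adjoint = G)
    (hsv : ∀ y, (0, y) ∈ G → y = 0) {V P : E →L[ℂ] E} (hV : IsSelfAdjoint V)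
    (hP : IsStarProjection P) (hPG : PreservesGraph G P) {μ c : ℝ} (hc : 0 < c)
    (h : ∀ x y, (x, y) ∈ perturb G V →
      c * ‖x‖ ^ 2 ≤ (inner ℂ (x - (2 : ℂ) • P x) (y - (μ : ℂ) • x)).re) :
    ∃ F : E →L[ℂ] E, IsStarProjection F ∧ PreservesGraph (perturb G V) F ∧
      (∀ B : E →L[ℂ] E, IsSelfAdjoint B → PreservesGraph (perturb G V) B → Commute F B) ∧
      ∀ x, ‖F x - P x‖ ^ 2 ≤ (1 - c / (c + ‖V‖)) / 2 * ‖x‖ ^ 2 := by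
  have hμs : IsSelfAdjoint (-((μ : ℂ) • (1 : E →L[ℂ] E))) :=
    (IsSelfAdjoint.smul (show IsSelfAdjoint (μ : ℂ) from Complex.conj_ofReal _)
      (IsSelfAdjoint.one _)).neg
  set G₁ := perturb G V with hG₁
  set G₂ := perturb G₁ (-((μ : ℂ) • (1 : E →L[ℂ] E))) with hG₂
  have hmem {x y : E} : (x, y) ∈ G₂ ↔ (x, y + (μ : ℂ) • x) ∈ G₁ := by
    rw [hG₂, mem_perturb, neg_apply, sub_neg_eq_add]
    rfl
  have ha₁ : G₁.adjoint = G₁ := adjoint_perturb hG hV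
  have ha₂ : G₂.adjoint = G₂ := adjoint_perturb ha₁ hμs
  have h' {x y : E} (hxy : (x, y) ∈ G₂) :
      c * ‖x‖ ^ 2 ≤ (inner ℂ (x - (2 : ℂ) • P x) y).re := by
    have := h _ _ (hmem.1 hxy)
    rwa [add_sub_cancel_right] at this
  obtain ⟨R, hRs, hRinj, hR⟩ := exists_inverse_of_bound ha₂ hc (fun x y hxy => by
    have h1 := (h' hxy).trans ((Complex.re_le_norm _).trans (norm_inner_le_norm _ _))
    rw [norm_one_sub_two_smul_apply hP] at h1
    rcases (norm_nonneg x).eq_or_lt with h0 | h0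
    · rw [← h0, mul_zero]; exact norm_nonneg _
    · refine le_of_mul_le_mul_left ?_ h0
      linarith) (fun y hy => by
    rw [hmem, hG₁, mem_perturb] at hy
    simpa using hsv _ hy)
  have hcommR {B : E →L[ℂ] E} (hB : PreservesGraph G₁ B) : Commute R B := by
    ext y
    have h1 := hB _ _ (hmem.1 ((hR _ y).2 rfl))
    rw [map_add, map_smul, ← hmem, hR] at h1
    exact h1.symm
  have hpres {B : E →L[ℂ] E} (hB : Commute R B) : PreservesGraph G₁ B := by
    intro x y hxy
    have e : y = (y - (μ : ℂ) • x) + (μ : ℂ) • x := by rw [sub_add_cancel]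
    rw [e, ← hmem, hR] at hxy
    rw [e, map_add, map_smul, ← hmem, hR]
    nth_rewrite 1 [hxy]
    exact congrArg (fun T : E →L[ℂ] E => T (y - (μ : ℂ) • x)) hB.symm
  have hFR := commute_negProj hRs (Commute.refl R)
  refine ⟨negProj R, isStarProjection_negProj R, hpres hFR.symm,
    fun B hB hBG => commute_negProj hB (hcommR hBG), ?_⟩
  have hκ : 0 ≤ c / (c + ‖V‖) := by positivity
  have hJ (y : E) : (1 - (2 : ℂ) • P : E →L[ℂ] E) y = y - (2 : ℂ) • P y := rfl
  have h2 : IsSelfAdjoint (2 : ℂ) := by simp [IsSelfAdjoint]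
  have hJs : IsSelfAdjoint (1 - (2 : ℂ) • P) :=
    (IsSelfAdjoint.one _).sub (h2.smul hP.isSelfAdjoint)
  set J : E →L[ℂ] E := 1 - (2 : ℂ) • P with hJdef
  have hJJ (y : E) : J (J y) = y := by
    have h : P (P y) = P y := congrArg (fun T : E →L[ℂ] E => T y) hP.isIdempotentElem.eq
    rw [hJ, hJ, map_sub, map_smul, h]
    module
  have hJn (y : E) : ‖J y‖ = ‖y‖ := by rw [hJ]; exact norm_one_sub_two_smul_apply hP y
  refine norm_negProj_sub_sq_le hRs hRinj hP hκ (fun x => ?_) (fun x => ?_)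
  · have h1 := h' ((hR _ x).2 rfl)
    rw [mul_apply_eq_comp, hJ]
    exact le_trans (by positivity) h1
  · have hu : (R x, x) ∈ G₂ := (hR _ _).2 rfl
    -- `J` commutes with `T`, so moving it past `T + V - μ` costs only the bounded commutator `V J -
    -- J V`.
    have hJu : (J (R x), J x - J (V (R x)) + V (J (R x))) ∈ G₂ := by
      rw [hmem, hG₁, mem_perturb] at hu ⊢
      have e := G.sub_mem hu (G.smul_mem 2 (hPG _ _ hu))
      convert e using 1
      simp only [hJ, Prod.smul_mk, Prod.mk_sub_mk, map_sub, map_add, map_smul, Prod.mk.injEq,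
        true_and]
      module
    have hJx : (R (J x), J x) ∈ G₂ := (hR _ _).2 rfl
    -- Write `J R x = v + w` with `v`, `w` the symmetrized and antisymmetrized halves of `J R` and
    -- `R J` at `x`. Then `(T + V - μ) w = W (v + w)`, where `W` is the part of `V` off-diagonal for
    -- `J`. Since `W` anticommutes with `J`, `Re ⟨J w, W w⟩ = 0`, and the lower bound gives `c ‖w‖ ≤
    -- ‖V‖ ‖v‖`. Thus `‖R x‖ ≤ (1 + ‖V‖ / c) ‖v‖`, whence `κ = c / (c + ‖V‖)`.
    set v := (1 / 2 : ℂ) • (J * R + R * J) x with hv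
    have hv' : v = (1 / 2 : ℂ) • (J (R x) + R (J x)) := rfl
    have hw := h' (G₂.smul_mem (1 / 2 : ℂ) (G₂.sub_mem hJu hJx))
    set w := J (R x) - v with hw_def
    have e1 : (1 / 2 : ℂ) • (J (R x) - R (J x)) = w := by
      rw [hw_def, hv']; module
    have hw1 : c * ‖w‖ ^ 2 ≤ (inner ℂ (J w) ((1 / 2 : ℂ) • (V (J (R x)) - J (V (R x))))).re := by
      have e3 : (1 / 2 : ℂ) • (J x - J (V (R x)) + V (J (R x)) - J x) =
          (1 / 2 : ℂ) • (V (J (R x)) - J (V (R x))) := by module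
      simp only [Prod.mk_sub_mk] at hw
      rwa [e1, e3, ← hJ] at hw
    set W : E →L[ℂ] E := (1 / 2 : ℂ) • (V - J * V * J) with hW
    have hWapp (y : E) : W y = (1 / 2 : ℂ) • (V y - J (V (J y))) := rfl
    have hWn (y : E) : ‖W y‖ ≤ ‖V‖ * ‖y‖ := by
      rw [hWapp, norm_smul]
      have a1 := norm_sub_le (V y) (J (V (J y)))
      rw [hJn] at a1
      have a2 := V.le_opNorm y
      have a3 := V.le_opNorm (J y)
      rw [hJn] at a3
      norm_num
      linarith
    have hWJ (y : E) : (inner ℂ (J y) (W y)).re = 0 := by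
      rw [hWapp, inner_smul_right, inner_sub_right, ← inner_apply_comm hJs, hJJ,
        ← inner_apply_comm hV y, ← inner_conj_symm (V y) (J y)]
      simp [re_inner_comm (V y)]
    have e2 : (1 / 2 : ℂ) • (V (J (R x)) - J (V (R x))) = W v + W w := by
      rw [← map_add, hw_def, add_sub_cancel, hWapp, hJJ]
    rw [e2, inner_add_right, Complex.add_re, hWJ, add_zero] at hw1
    have hw2 : c * ‖w‖ ≤ ‖V‖ * ‖v‖ := by
      have h1 := hw1.trans ((Complex.re_le_norm _).trans (norm_inner_le_norm _ _))
      rw [hJn] at h1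
      have h3 := hWn v
      rcases (norm_nonneg w).eq_or_lt with h0 | h0
      · rw [← h0, mul_zero]; positivity
      · refine le_of_mul_le_mul_left ?_ h0
        nlinarith
    have hw3 : ‖R x‖ ≤ ‖w‖ + ‖v‖ := by
      rw [← hJn]
      have : J (R x) = w + v := by rw [hw_def, sub_add_cancel]
      rw [this]; exact norm_add_le _ _
    have hv2 : 2 * ‖v‖ = ‖(J * R + R * J) x‖ := by
      rw [hv, norm_smul]
      norm_num
      ring
    rw [← hv2, mul_assoc]
    refine mul_le_mul_of_nonneg_left ?_ zero_le_two
    rw [div_mul_eq_mul_div, div_le_iff₀ (by positivity)]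
    nlinarith

end Relation

-- The binomial series of `(1 - X)^{-1/2}` and its commutators.

section InverseSqrt

theorem choose_neg_half (n : ℕ) :
    Ring.choose (-1 / 2 : ℝ) n = (-1) ^ n * (n.centralBinom / 4 ^ n) := by
  induction n with
  | zero => simp
  | succ n ih =>
    have h1 := Ring.descPochhammer_eq_factorial_smul_choose (-1 / 2 : ℝ) n
    have h2 := Ring.descPochhammer_eq_factorial_smul_choose (-1 / 2 : ℝ) (n + 1)
    rw [descPochhammer_succ_right, Polynomial.smeval_mul, h1, ih] at h2
    have h4 : ((n : ℝ) + 1) * (n + 1).centralBinom = 2 * (2 * n + 1) * n.centralBinom := by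
      exact_mod_cast Nat.succ_mul_centralBinom_succ n
    simp only [nsmul_eq_mul, Polynomial.smeval_sub, Polynomial.smeval_X, pow_one,
      Polynomial.smeval_natCast, pow_zero, mul_one, Nat.factorial_succ, Nat.cast_mul,
      Nat.cast_add, Nat.cast_one] at h2
    have hn : ((n : ℝ) + 1) ≠ 0 := by positivity
    have hf : (n.factorial : ℝ) ≠ 0 := by positivity
    apply mul_left_cancel₀ (mul_ne_zero hn hf)
    rw [← h2, pow_succ, pow_succ]
    field_simp
    linear_combination 2 * h4

theorem choose_neg_one (n : ℕ) : Ring.choose (-1 : ℝ) n = (-1) ^ n := by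
  rw [Ring.choose_neg]
  simp only [add_sub_cancel_left, Ring.choose_natCast, Nat.choose_self, Nat.cast_one]
  rw [Int.negOnePow_def]
  simp [Units.smul_def]

/-- Vandermonde's identity for the exponents `-1/2 + -1/2 = -1`: the square of the binomial series
is the geometric series. -/
theorem sum_antidiagonal_centralBinom (n : ℕ) :
    ∑ k ∈ Finset.HasAntidiagonal.antidiagonal n,
      ((k.1.centralBinom / 4 ^ k.1 : ℝ)) * (k.2.centralBinom / 4 ^ k.2) = 1 := by
  have h := Ring.add_choose_eq n (Commute.all (-1 / 2 : ℝ) (-1 / 2 : ℝ))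
  rw [show (-1 / 2 : ℝ) + -1 / 2 = -1 by norm_num, choose_neg_one] at h
  have h2 : ((-1 : ℝ)) ^ n * ∑ k ∈ Finset.HasAntidiagonal.antidiagonal n,
      ((k.1.centralBinom / 4 ^ k.1 : ℝ)) * (k.2.centralBinom / 4 ^ k.2) = (-1) ^ n := by
    refine Eq.trans ?_ h.symm
    rw [Finset.mul_sum]
    refine Finset.sum_congr rfl fun k hk => ?_
    rw [choose_neg_half, choose_neg_half, ← Finset.HasAntidiagonal.mem_antidiagonal.1 hk, pow_add]
    ring
  have h3 : ((-1 : ℝ)) ^ n ≠ 0 := by simp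
  exact mul_left_cancel₀ h3 (h2.trans (mul_one _).symm)

variable {E : Type*} [NormedAddCommGroup E] [InnerProductSpace ℂ E] [CompleteSpace E]

/-- The inverse square root of `1 - X` for `‖X‖ < 1`; it inherits commutation properties and
boundedness of commutators with unbounded self-adjoint operators from `X`. -/
theorem exists_inverse_sqrt {X : E →L[ℂ] E} (hX : IsSelfAdjoint X) (hX1 : ‖X‖ < 1) :
    ∃ Z : E →L[ℂ] E, IsSelfAdjoint Z ∧ Z * Z * (1 - X) = 1 ∧ (1 - X) * (Z * Z) = 1 ∧
      (∀ B, Commute B X → Commute B Z) ∧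
      ∀ (G : Submodule ℂ (E × E)), G.adjoint = G → ∀ K : E →L[ℂ] E,
        (∀ x y, (x, y) ∈ G → (X x, X y + K x) ∈ G) →
        ∃ K' : E →L[ℂ] E, ∀ x y, (x, y) ∈ G → (Z x, Z y + K' x) ∈ G := by
  set b : ℕ → ℂ := fun n => ((n.centralBinom / 4 ^ n : ℝ) : ℂ) with hb
  have hb1 (n : ℕ) : ‖b n‖ ≤ 1 := by
    rw [hb, Complex.norm_real, Real.norm_of_nonneg (by positivity), div_le_one (by positivity)]
    exact_mod_cast Nat.centralBinom_le_four_pow n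
  have hpn (n : ℕ) : ‖X ^ n‖ ≤ ‖X‖ ^ n := by
    rcases n with - | n
    · rw [pow_zero, pow_zero]; exact ContinuousLinearMap.norm_id_le
    · exact norm_pow_le' X n.succ_pos
  have hbn (n : ℕ) : ‖b n • X ^ n‖ ≤ ‖X‖ ^ n := by
    rw [norm_smul]
    calc _ ≤ 1 * ‖X‖ ^ n := by gcongr; exacts [hb1 n, hpn n]
      _ = _ := one_mul _
  have hgeom := summable_geometric_of_lt_one (norm_nonneg X) hX1
  have hsn : Summable fun n => ‖b n • X ^ n‖ :=
    Summable.of_nonneg_of_le (fun _ => norm_nonneg _) hbn hgeom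
  have hs := hsn.of_norm
  set Z := ∑' n, b n • X ^ n with hZ
  have hcomm (B : E →L[ℂ] E) (hB : Commute B X) : Commute B Z :=
    Commute.tsum_right _ fun n => (hB.pow_right n).smul_right _
  have hZZ : Z * Z = ∑' n, X ^ n := by
    rw [hZ, tsum_mul_tsum_eq_tsum_sum_antidiagonal_of_summable_norm hsn hsn]
    refine tsum_congr fun n => ?_
    have h1 : (∑ k ∈ Finset.HasAntidiagonal.antidiagonal n, b k.1 * b k.2) = 1 := by
      have := congrArg (fun r : ℝ => (r : ℂ)) (sum_antidiagonal_centralBinom n)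
      simpa [hb] using this
    rw [← one_smul ℂ (X ^ n), ← h1, Finset.sum_smul]
    refine Finset.sum_congr rfl fun k hk => ?_
    rw [smul_mul_smul_comm, ← pow_add, Finset.HasAntidiagonal.mem_antidiagonal.1 hk]
  have hinv : Z * Z * (1 - X) = 1 := by
    rw [hZZ]
    exact geom_series_mul_neg X hX1
  have hXZ : Commute (1 - X) Z := hcomm _ ((Commute.one_left X).sub_left (Commute.refl X))
  refine ⟨Z, ?_, hinv, ?_, hcomm, fun G hG K hK => ?_⟩
  · rw [hZ, IsSelfAdjoint, tsum_star]
    refine tsum_congr fun n => ?_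
    rw [star_smul, star_pow, hX.star_eq]
    congr 1
    exact Complex.conj_ofReal _
  · exact (hXZ.mul_right hXZ).eq.trans hinv
  -- `Kp n` is the commutator of the operator with graph `G` and `Xⁿ`, built by the Leibniz rule.
  -- Its norm is at most `n ‖X‖ⁿ⁻¹ ‖K‖`, so the commutators can be summed, and closedness of `G`
  -- passes to the limit.
  · let Kp : ℕ → E →L[ℂ] E := fun n => Nat.rec 0 (fun n T => X * T + K * X ^ n) n
    have hKp0 : Kp 0 = 0 := rfl
    have hKps (n : ℕ) : Kp (n + 1) = X * Kp n + K * X ^ n := rfl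
    have hKpG (n : ℕ) : ∀ x y, (x, y) ∈ G → ((X ^ n) x, (X ^ n) y + Kp n x) ∈ G := by
      induction n with
      | zero => intro x y hxy; simpa [hKp0] using hxy
      | succ n ih =>
        intro x y hxy
        have h1 := hK _ _ (ih x y hxy)
        rw [pow_succ', hKps]
        simpa [add_assoc] using h1
    have hKpn (n : ℕ) : ‖Kp (n + 1)‖ ≤ (n + 1) * ‖X‖ ^ n * ‖K‖ := by
      induction n with
      | zero =>
        rw [hKps, hKp0, mul_zero, zero_add]
        simp
      | succ n ih =>
        rw [hKps (n + 1)]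
        calc _ ≤ ‖X * Kp (n + 1)‖ + ‖K * X ^ (n + 1)‖ := norm_add_le _ _
          _ ≤ ‖X‖ * ‖Kp (n + 1)‖ + ‖K‖ * ‖X ^ (n + 1)‖ :=
            add_le_add (norm_mul_le _ _) (norm_mul_le _ _)
          _ ≤ ‖X‖ * ((n + 1) * ‖X‖ ^ n * ‖K‖) + ‖K‖ * ‖X‖ ^ (n + 1) := by
            gcongr
            exact hpn _
          _ = _ := by push_cast; ring
    have hsK : Summable fun n => b n • Kp n := by
      rw [← summable_nat_add_iff 1]
      have h1 : Summable fun n : ℕ => ((n : ℝ) + 1) * ‖X‖ ^ n * ‖K‖ := by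
        refine Summable.mul_right _ ?_
        have h2 := summable_pow_mul_geometric_of_norm_lt_one 1 (r := ‖X‖) (by simpa using hX1)
        refine (h2.add hgeom).congr fun n => ?_
        ring
      refine Summable.of_norm_bounded h1 fun n => ?_
      rw [norm_smul]
      calc _ ≤ 1 * ((n + 1) * ‖X‖ ^ n * ‖K‖) := by
            gcongr
            · exact hb1 _
            · exact hKpn n
        _ = _ := one_mul _
    refine ⟨∑' n, b n • Kp n, fun x y hxy => ?_⟩
    have hZt (z : E) : Tendsto (fun N => ∑ n ∈ Finset.range N, (b n • X ^ n) z) atTop (𝓝 (Z z)) := by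
      have h1 := hs.hasSum.tendsto_sum_nat
      have h2 := ((ContinuousLinearMap.apply ℂ E z).continuous.tendsto _).comp h1
      refine h2.congr fun N => ?_
      simp [Function.comp]
    have hKt (z : E) : Tendsto (fun N => ∑ n ∈ Finset.range N, (b n • Kp n) z) atTop
        (𝓝 ((∑' n, b n • Kp n) z)) := by
      have h1 := hsK.hasSum.tendsto_sum_nat
      have h2 := ((ContinuousLinearMap.apply ℂ E z).continuous.tendsto _).comp h1
      refine h2.congr fun N => ?_
      simp [Function.comp]
    refine mem_of_tendsto_graph hG (fun N => ?_) (hZt x) ((hZt y).add (hKt x))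
    rw [← Finset.sum_add_distrib]
    have := G.sum_mem (t := Finset.range N) fun n _ => G.smul_mem (b n) (hKpG n x y hxy)
    convert this using 1
    simp [Prod.ext_iff, Prod.fst_sum, Prod.snd_sum, smul_add]

end InverseSqrt

-- The unitary as a polar factor of `∑ pₙ qₙ`.

section Assembly

variable {E : Type*} [NormedAddCommGroup E] [InnerProductSpace ℂ E] [CompleteSpace E]

/-- A complete sequence of mutually disjoint orthogonal projections. -/
structure IsResolution (p : ℕ → E →L[ℂ] E) : Prop where
  proj : ∀ n, IsStarProjection (p n)
  disj : ∀ n m, n ≠ m → p n * p m = 0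
  tendsto : ∀ x, Tendsto (fun N => ∑ n ∈ Finset.range N, p n x) atTop (𝓝 x)

namespace IsResolution

variable {p q : ℕ → E →L[ℂ] E}

theorem apply_self (hp : IsResolution p) (n : ℕ) (x : E) : p n (p n x) = p n x :=
  congrArg (fun T : E →L[ℂ] E => T x) (hp.proj n).isIdempotentElem.eq

theorem apply_of_ne (hp : IsResolution p) {n m : ℕ} (h : n ≠ m) (x : E) : p n (p m x) = 0 :=
  congrArg (fun T : E →L[ℂ] E => T x) (hp.disj n m h)

theorem inner_eq_zero (hp : IsResolution p) {n m : ℕ} (h : n ≠ m) (x y : E) :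
    inner ℂ (p n x) (p m y) = 0 := by
  rw [inner_apply_comm (hp.proj n).isSelfAdjoint, hp.apply_of_ne h, inner_zero_right]

theorem norm_sum_sq (hp : IsResolution p) (s : Finset ℕ) (v : ℕ → E) :
    ‖∑ n ∈ s, p n (v n)‖ ^ 2 = ∑ n ∈ s, ‖p n (v n)‖ ^ 2 := by
  classical
  induction s using Finset.induction_on with
  | empty => simp
  | insert a s ha ih =>
    rw [Finset.sum_insert ha, Finset.sum_insert ha, norm_add_sq_complex, ih, inner_sum]
    rw [Finset.sum_eq_zero fun n hn => hp.inner_eq_zero (by rintro rfl; exact ha hn) _ _]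
    simp

theorem tendsto_norm_sq (hp : IsResolution p) (x : E) :
    Tendsto (fun N => ∑ n ∈ Finset.range N, ‖p n x‖ ^ 2) atTop (𝓝 (‖x‖ ^ 2)) :=
  ((hp.tendsto x).norm.pow 2).congr fun _ => hp.norm_sum_sq _ fun _ => x

theorem apply_sum_range (hp : IsResolution p) {j N : ℕ} (hj : j < N) (v : ℕ → E) :
    p j (∑ n ∈ Finset.range N, p n (v n)) = p j (v j) := by
  rw [map_sum, Finset.sum_eq_single j]
  · exact hp.apply_self _ _
  · exact fun n _ hn => hp.apply_of_ne hn.symm _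
  · exact fun h => absurd (Finset.mem_range.2 hj) h

/-- The block diagonal operator `∑ pₙ W qₙ`. -/
theorem exists_diagonal (hp : IsResolution p) (hq : IsResolution q) (W : E →L[ℂ] E) :
    ∃ S : E →L[ℂ] E, ∀ x,
      Tendsto (fun N => ∑ n ∈ Finset.range N, p n (W (q n x))) atTop (𝓝 (S x)) := by
  have hlim (x : E) : ∃ y,
      Tendsto (fun N => ∑ n ∈ Finset.range N, p n (W (q n x))) atTop (𝓝 y) := by
    apply cauchySeq_tendsto_of_complete
    have hsum : Summable fun n => ‖q n x‖ ^ 2 := by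
      refine summable_of_sum_range_le (c := ‖x‖ ^ 2) (fun n => by positivity) fun N => ?_
      have hmono : Monotone fun N => ∑ n ∈ Finset.range N, ‖q n x‖ ^ 2 :=
        monotone_nat_of_le_succ fun _ => by
          rw [Finset.sum_range_succ]; exact le_add_of_nonneg_right (by positivity)
      exact hmono.ge_of_tendsto (hq.tendsto_norm_sq x) N
    -- Pythagoras: the terms are mutually orthogonal and bounded by `‖W‖ ‖qₙ x‖`, which is square
    -- summable.
    have hsummable : Summable fun n => p n (W (q n x)) := by
      rw [summable_iff_vanishing_norm]
      intro ε hε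
      obtain ⟨s, hs⟩ := summable_iff_vanishing_norm.1 hsum (ε ^ 2 / (‖W‖ ^ 2 + 1)) (by positivity)
      refine ⟨s, fun t ht => ?_⟩
      have h1 := hs t ht
      rw [Real.norm_of_nonneg (Finset.sum_nonneg fun _ _ => by positivity),
        lt_div_iff₀ (by positivity)] at h1
      have h2 : ‖∑ n ∈ t, p n (W (q n x))‖ ^ 2 ≤ ‖W‖ ^ 2 * ∑ n ∈ t, ‖q n x‖ ^ 2 := by
        rw [hp.norm_sum_sq t fun n => W (q n x), Finset.mul_sum]
        refine Finset.sum_le_sum fun n _ => ?_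
        rw [← mul_pow]
        exact pow_le_pow_left₀ (norm_nonneg _)
          ((norm_apply_le_of_isStarProjection (hp.proj n) _).trans (W.le_opNorm _)) 2
      have h3 : 0 ≤ ∑ n ∈ t, ‖q n x‖ ^ 2 := Finset.sum_nonneg fun _ _ => by positivity
      refine lt_of_pow_lt_pow_left₀ 2 hε.le ?_
      linarith
    exact hsummable.hasSum.tendsto_sum_nat.cauchySeq
  choose f hf using hlim
  refine ⟨continuousLinearMapOfTendsto (l := atTop)
    (fun N => ∑ n ∈ Finset.range N, p n * W * q n) (f := f) ?_, fun x => hf x⟩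
  rw [tendsto_pi_nhds]
  intro x
  refine (hf x).congr fun N => ?_
  simp [sum_apply]

end IsResolution

/-- If the projections `qₙ` reduce `T + V`, the `pₙ` reduce `T`, and `pₙ`, `qₙ` are uniformly close
in the sense of the two lower bounds, then a unitary operator that preserves the domain carries
`qₙ` to `pₙ`. -/
theorem exists_unitary_of_resolutions {G : Submodule ℂ (E × E)} (hG : G.adjoint = G)
    {V : E →L[ℂ] E} (hV : IsSelfAdjoint V) {p q : ℕ → E →L[ℂ] E} (hp : IsResolution p)
    (hq : IsResolution q) (hpG : ∀ n, PreservesGraph G (p n))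
    (hqG : ∀ n, PreservesGraph (perturb G V) (q n)) {δ : ℝ} (hδ : 0 < δ)
    (hpq : ∀ n x, δ * ‖q n x‖ ^ 2 ≤ ‖p n (q n x)‖ ^ 2)
    (hqp : ∀ n x, δ * ‖p n x‖ ^ 2 ≤ ‖q n (p n x)‖ ^ 2) :
    ∃ U : E ≃ₗᵢ[ℂ] E, (∀ n x, U (q n x) = p n (U x)) ∧
      (∀ x y, (x, y) ∈ perturb G V → ∃ z, (U x, z) ∈ G) ∧
      ∀ x y, (x, y) ∈ G → ∃ z, (U.symm x, z) ∈ perturb G V := by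
  have hG' : (perturb G V).adjoint = perturb G V := adjoint_perturb hG hV
  obtain ⟨S, hS⟩ := hp.exists_diagonal hq 1
  obtain ⟨B, hB⟩ := hp.exists_diagonal hq V
  simp only [one_apply_eq_self] at hS
  -- On each block `T pₙ qₙ = pₙ T qₙ = pₙ qₙ (T + V) - pₙ V qₙ`, so `S` intertwines up to the
  -- bounded error `B`. The companion for `star S` follows by duality.
  have hSG (x y : E) (hxy : (x, y) ∈ perturb G V) : (S x, S y - B x) ∈ G := by
    refine mem_of_tendsto_graph hG (fun N => ?_) (hS x) ((hS y).sub (hB x))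
    rw [← Finset.sum_sub_distrib]
    have := G.sum_mem (t := Finset.range N) fun n _ => hpG n _ _ (mem_perturb.1 (hqG n x y hxy))
    convert this using 1
    simp [Prod.ext_iff, Prod.fst_sum, Prod.snd_sum]
  have hSG' (x y : E) (hxy : (x, y) ∈ G) : (star S x, star S y + star B x) ∈ perturb G V := by
    refine mem_of_inner_eq hG' fun a b hab => ?_
    have h1 := inner_eq_of_mem hG hxy (hSG a b hab)
    rw [inner_add_right, ContinuousLinearMap.star_eq_adjoint, ContinuousLinearMap.star_eq_adjoint,
      ContinuousLinearMap.adjoint_inner_right, ContinuousLinearMap.adjoint_inner_right,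
      ContinuousLinearMap.adjoint_inner_right, ← h1, inner_sub_left, sub_add_cancel]
  have hpS (j : ℕ) (x : E) : p j (S x) = p j (q j x) := by
    refine tendsto_nhds_unique (((p j).continuous.tendsto _).comp (hS x)) ?_
    refine tendsto_const_nhds.congr' ?_
    filter_upwards [eventually_gt_atTop j] with N hN
    exact (hp.apply_sum_range hN fun n => q n x).symm
  have hSq (j : ℕ) (x : E) : S (q j x) = p j (q j x) := by
    refine tendsto_nhds_unique (hS (q j x)) ?_
    refine tendsto_const_nhds.congr' ?_
    filter_upwards [eventually_gt_atTop j] with N hN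
    rw [Finset.sum_eq_single j]
    · rw [hq.apply_self]
    · intro n _ hn; rw [hq.apply_of_ne hn, map_zero]
    · exact fun h => absurd (Finset.mem_range.2 hN) h
  have hcommS (j : ℕ) : p j * S = S * q j := by
    ext x; exact (hpS j x).trans (hSq j x).symm
  have hSlow (x : E) : δ * ‖x‖ ^ 2 ≤ ‖S x‖ ^ 2 := by
    refine le_of_tendsto_of_tendsto' ((hq.tendsto_norm_sq x).const_mul δ) ((hS x).norm.pow 2)
      fun N => ?_
    rw [hp.norm_sum_sq _ fun n => q n x, Finset.mul_sum]
    exact Finset.sum_le_sum fun n _ => hpq n x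
  have hSup (x : E) : ‖S x‖ ^ 2 ≤ ‖x‖ ^ 2 := by
    refine le_of_tendsto_of_tendsto' ((hS x).norm.pow 2) (hq.tendsto_norm_sq x) fun N => ?_
    rw [hp.norm_sum_sq _ fun n => q n x]
    exact Finset.sum_le_sum fun n _ => pow_le_pow_left₀ (norm_nonneg _)
      (norm_apply_le_of_isStarProjection (hp.proj n) _) 2
  have hcommS' (j : ℕ) : star S * p j = q j * star S := by
    have := congrArg star (hcommS j)
    rwa [star_mul, star_mul, (hp.proj j).isSelfAdjoint.star_eq,
      (hq.proj j).isSelfAdjoint.star_eq] at this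
  -- Injectivity of `star S` is what makes `U` surjective; this is where the second lower bound
  -- enters.
  have hSinj (x : E) (hx : star S x = 0) : x = 0 := by
    have h1 (j : ℕ) : p j x = 0 := by
      have h2 : q j * p j = q j * star S := by
        have h4 : p j * S = p j * q j := by ext x; exact hpS j x
        have h5 := congrArg star h4
        rw [star_mul, star_mul, (hp.proj j).isSelfAdjoint.star_eq,
          (hq.proj j).isSelfAdjoint.star_eq] at h5
        rw [← h5, hcommS']
      have h3 : q j (p j x) = 0 := by
        have := congrArg (fun T : E →L[ℂ] E => T x) h2
        simpa [hx] using this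
      have h4 := hqp j x
      rw [h3, norm_zero] at h4
      have h5 : ‖p j x‖ ^ 2 ≤ 0 := by
        by_contra hneg
        have := mul_pos hδ (not_le.1 hneg)
        linarith
      exact norm_eq_zero.1 (pow_eq_zero_iff two_ne_zero |>.1 (le_antisymm h5 (by positivity)))
    exact tendsto_nhds_unique (hp.tendsto x) (by simp [h1])
  -- the polar decomposition of `S`
  set X : E →L[ℂ] E := 1 - star S * S with hX
  have hXs : IsSelfAdjoint X := (IsSelfAdjoint.one _).sub (IsSelfAdjoint.star_mul_self S)
  have hXre (x : E) : (inner ℂ (X x) x).re = ‖x‖ ^ 2 - ‖S x‖ ^ 2 := by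
    have : X x = x - star S (S x) := rfl
    rw [this, inner_sub_left, Complex.sub_re, re_inner_self, ContinuousLinearMap.star_eq_adjoint,
      ContinuousLinearMap.adjoint_inner_left, re_inner_self]
  have hX0 : 0 ≤ X := nonneg_iff_re_inner.2 ⟨hXs, fun x => by
    rw [hXre]; linarith [hSup x]⟩
  -- The maximum with `0` keeps the candidate bound nonnegative, since `δ > 1` is not excluded.
  have hX1 : ‖X‖ < 1 := by
    refine lt_of_le_of_lt ((CStarAlgebra.norm_le_iff_le_algebraMap X
      (le_max_left 0 (1 - δ)) hX0).2 ?_) (max_lt one_pos (by linarith))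
    rw [← sub_nonneg]
    refine nonneg_iff_re_inner.2 ⟨IsSelfAdjoint.sub (.algebraMap _ (.all _)) hXs, fun x => ?_⟩
    have e : (algebraMap ℝ (E →L[ℂ] E) (max 0 (1 - δ))) x = ((max 0 (1 - δ) : ℝ) : ℂ) • x := rfl
    rw [sub_apply, e, inner_sub_left, inner_smul_left, Complex.conj_ofReal, Complex.sub_re,
      Complex.re_ofReal_mul, hXre, re_inner_self]
    have h1 := hSlow x
    have h2 := mul_le_mul_of_nonneg_right (le_max_right 0 (1 - δ)) (sq_nonneg ‖x‖)
    linarith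
  obtain ⟨Z, hZs, hZ1, hZ2, hZcomm, hZG⟩ := exists_inverse_sqrt hXs hX1
  have hXe : 1 - X = star S * S := by rw [hX, sub_sub_cancel]
  rw [hXe] at hZ1 hZ2
  have hZS : Commute (star S * S) Z :=
    hZcomm _ (by rw [hX]; exact (Commute.one_right _).sub_right (Commute.refl _))
  have hqZ (j : ℕ) : Commute (q j) Z := by
    refine hZcomm _ ((Commute.one_right _).sub_right ?_)
    rw [commute_iff_eq, ← mul_assoc, ← hcommS', mul_assoc, hcommS, mul_assoc]
  set U := S * Z with hU
  have hUs : star U = Z * star S := by rw [hU, star_mul, hZs.star_eq]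
  have hU1 : star U * U = 1 := by
    rw [hUs, hU, ← hZ1, mul_assoc, ← mul_assoc (star S) S Z, hZS.eq, mul_assoc]
  have hZinj (x : E) (hx : Z x = 0) : x = 0 := by
    have h : Z * Z * (star S * S) = star S * S * Z * Z := by rw [hZ1, mul_assoc, hZ2]
    have := congrArg (fun T : E →L[ℂ] E => T x) (h.symm.trans hZ1)
    simpa [hx] using this.symm
  have hU2 : U * star U = 1 := by
    have h1 : star U * (1 - U * star U) = 0 := by
      rw [mul_sub, ← mul_assoc, hU1]; simp
    ext x
    have h2 : star U ((1 - U * star U) x) = 0 := congrArg (fun T : E →L[ℂ] E => T x) h1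
    have h3 : (1 - U * star U) x = 0 := by
      refine hSinj _ (hZinj _ ?_)
      rw [← mul_apply_eq_comp, ← hUs]
      exact h2
    rw [sub_apply, sub_eq_zero] at h3
    exact h3.symm
  have hUmem : U ∈ unitary (E →L[ℂ] E) := ⟨hU1, hU2⟩
  let e : E ≃ₗᵢ[ℂ] E := Unitary.linearIsometryEquiv ⟨U, hUmem⟩
  have he (x : E) : e x = U x := rfl
  have hes (x : E) : e.symm x = star U x := by
    rw [LinearIsometryEquiv.symm_apply_eq, he]
    exact (congrArg (fun T : E →L[ℂ] E => T x) hU2).symm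
  -- Combining the intertwining relations of `S` and `star S`, the commutator of `T + V` with `X = 1
  -- - S*S` is the bounded operator `S*B - B*S`.
  obtain ⟨K', hK'⟩ := hZG (perturb G V) hG' (star S * B - star B * S) (fun x y hxy => by
    have h1 := hSG' _ _ (hSG x y hxy)
    have h2 := (perturb G V).sub_mem hxy h1
    convert h2 using 1
    simp only [hX, sub_apply, one_apply_eq_self, mul_apply_eq_comp, map_sub, Prod.mk_sub_mk,
      Prod.mk.injEq, true_and]
    abel)
  refine ⟨e, fun n x => ?_, fun x y hxy => ⟨_, hSG _ _ (hK' x y hxy)⟩, fun x y hxy => ?_⟩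
  · rw [he, he]
    have : U * q n = p n * U := by
      rw [hU, mul_assoc, ← (hqZ n).eq, ← mul_assoc, ← hcommS, mul_assoc]
    exact congrArg (fun T : E →L[ℂ] E => T x) this
  · rw [hes, hUs]
    exact ⟨_, hK' _ _ (hSG' x y hxy)⟩

end Assembly

-- From close commuting cuts to a resolution of the perturbed operator.

section Cuts

theorem eq_zero_of_norm_sq_le {E : Type*} [NormedAddCommGroup E] {x : E} {s : ℝ} (hs : s < 1) (h : ‖x‖ ^ 2 ≤ s * ‖x‖ ^ 2) :
    x = 0 := by
  have : ‖x‖ ^ 2 ≤ 0 := by nlinarith [sq_nonneg ‖x‖]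
  exact norm_eq_zero.1 (pow_eq_zero_iff two_ne_zero |>.1 (le_antisymm this (by positivity)))

variable {E : Type*} [NormedAddCommGroup E] [InnerProductSpace ℂ E]

/-- The partial sums of a resolution. -/
noncomputable def partialSum (p : ℕ → E →L[ℂ] E) (k : ℕ) : E →L[ℂ] E :=
  ∑ n ∈ Finset.range k, p n

theorem partialSum_apply (p : ℕ → E →L[ℂ] E) (k : ℕ) (x : E) :
    partialSum p k x = ∑ n ∈ Finset.range k, p n x := by
  simp [partialSum, sum_apply]

variable [CompleteSpace E]

theorem re_inner_apply_of_isStarProjection {P : E →L[ℂ] E} (hP : IsStarProjection P) (x : E) :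
    (inner ℂ x (P x)).re = ‖P x‖ ^ 2 := by
  have h : P (P x) = P x := congrArg (fun T : E →L[ℂ] E => T x) hP.isIdempotentElem.eq
  rw [← re_inner_self, inner_apply_comm hP.isSelfAdjoint, h]

theorem norm_sub_apply_sq {P : E →L[ℂ] E} (hP : IsStarProjection P) (x : E) :
    ‖x - P x‖ ^ 2 = ‖x‖ ^ 2 - ‖P x‖ ^ 2 := by
  rw [norm_sub_sq_complex, re_inner_apply_of_isStarProjection hP]
  ring

theorem IsResolution.isStarProjection_partialSum {p : ℕ → E →L[ℂ] E} (hp : IsResolution p)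
    (k : ℕ) : IsStarProjection (partialSum p k) := by
  refine ⟨?_, ?_⟩
  · rw [IsIdempotentElem, partialSum, Finset.sum_mul_sum]
    refine Finset.sum_congr rfl fun i hi => ?_
    rw [Finset.sum_eq_single i (fun j _ hj => hp.disj _ _ hj.symm) (fun h => absurd hi h)]
    exact (hp.proj i).isIdempotentElem
  · exact isSelfAdjoint_sum _ fun i _ => (hp.proj i).isSelfAdjoint

theorem IsResolution.norm_partialSum_sq {p : ℕ → E →L[ℂ] E} (hp : IsResolution p)
    (k : ℕ) (x : E) : ‖partialSum p k x‖ ^ 2 = ∑ n ∈ Finset.range k, ‖p n x‖ ^ 2 := by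
  rw [partialSum_apply]
  exact hp.norm_sum_sq _ fun _ => x

/-- Commuting spectral cuts `F k` of `T + V` that are closer than `1 / √2` to the cuts of a
resolution reducing `T` give a unitary block diagonalization. -/
theorem exists_unitary_of_cuts {G : Submodule ℂ (E × E)} (hG : G.adjoint = G)
    {V : E →L[ℂ] E} (hV : IsSelfAdjoint V) {p F : ℕ → E →L[ℂ] E} (hp : IsResolution p)
    (hpG : ∀ n, PreservesGraph G (p n)) (hF : ∀ k, IsStarProjection (F k))
    (hFG : ∀ k, PreservesGraph (perturb G V) (F k)) (hFF : ∀ k l, Commute (F k) (F l))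
    {s : ℝ} (hs : s < 1 / 2)
    (hclose : ∀ k x, ‖F k x - partialSum p k x‖ ^ 2 ≤ s * ‖x‖ ^ 2) :
    ∃ (q : ℕ → E →L[ℂ] E) (U : E ≃ₗᵢ[ℂ] E), (∀ n, PreservesGraph (perturb G V) (q n)) ∧
      (∀ n x, U (q n x) = p n (U x)) ∧
      (∀ x y, (x, y) ∈ perturb G V → ∃ z, (U x, z) ∈ G) ∧
      ∀ x y, (x, y) ∈ G → ∃ z, (U.symm x, z) ∈ perturb G V := by
  have hP := hp.isStarProjection_partialSum
  have happ {A B : E →L[ℂ] E} (h : A = B) (x : E) : A x = B x := congrArg (fun T => T x) h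
  have hself (k : ℕ) (x : E) : F k (F k x) = F k x := happ (hF k).isIdempotentElem.eq x
  -- A vector `z` in the range of `F k` and the kernel of `F l` has `‖P_k z‖² ≥ (1 - s) ‖z‖²` and
  -- `‖P_l z‖² ≤ s ‖z‖²`. As `P_k ≤ P_l` and `s < 1/2`, it vanishes.
  have hnested (k l : ℕ) (hkl : k ≤ l) : F l * F k = F k := by
    ext x
    set z := F k x - F l (F k x) with hz
    have h1 : F k z = z := by
      have := happ (hFF k l).eq (F k x)
      rw [mul_apply_eq_comp, mul_apply_eq_comp, hself] at this
      rw [hz, map_sub, hself, this]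
    have h2 : F l z = 0 := by rw [hz, map_sub, hself, sub_self]
    have h3 := hclose k z
    have h4 := hclose l z
    rw [h1, norm_sub_apply_sq (hP k)] at h3
    rw [h2, zero_sub, norm_neg] at h4
    have h5 : ‖partialSum p k z‖ ^ 2 ≤ ‖partialSum p l z‖ ^ 2 := by
      rw [hp.norm_partialSum_sq, hp.norm_partialSum_sq]
      exact Finset.sum_le_sum_of_subset_of_nonneg (Finset.range_mono hkl)
        fun _ _ _ => by positivity
    have h6 : z = 0 := eq_zero_of_norm_sq_le (s := 2 * s) (by linarith) (by linarith)
    exact (sub_eq_zero.1 h6).symm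
  have hnested' (k l : ℕ) (hkl : k ≤ l) : F k * F l = F k := (hFF k l).eq.trans (hnested k l hkl)
  have hF0 : F 0 = 0 := by
    ext x
    have h := hclose 0 (F 0 x)
    rw [hself, partialSum_apply, Finset.range_zero, Finset.sum_empty, sub_zero] at h
    exact eq_zero_of_norm_sq_le (by linarith) h
  set q : ℕ → E →L[ℂ] E := fun n => F (n + 1) - F n with hq
  have hqapp (n : ℕ) (x : E) : q n x = F (n + 1) x - F n x := rfl
  have hqproj (n : ℕ) : IsStarProjection (q n) := by
    refine ⟨?_, (hF _).isSelfAdjoint.sub (hF _).isSelfAdjoint⟩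
    rw [IsIdempotentElem, hq]
    simp only [mul_sub, sub_mul, (hF _).isIdempotentElem.eq, hnested n (n + 1) n.le_succ,
      hnested' n (n + 1) n.le_succ]
    abel
  have hqlt (n m : ℕ) (h : n < m) : q n * q m = 0 := by
    simp only [hq, mul_sub, sub_mul, hnested' (n + 1) (m + 1) (by lia), hnested' n (m + 1) (by lia),
      hnested' (n + 1) m (by lia), hnested' n m (by lia)]
    abel
  have htend (x : E) : Tendsto (fun N => F N x) atTop (𝓝 x) := by
    have hr (N : ℕ) := (isStarProjection_iff_eq_starProjection_range.1 (hF N))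
    choose hop hr using hr
    have hmono : Monotone fun N => LinearMap.range (F N).toLinearMap := by
      rintro k l hkl _ ⟨y, rfl⟩
      exact ⟨F k y, happ (hnested k l hkl) y⟩
    have := Submodule.starProjection_tendsto_self (fun N => LinearMap.range (F N).toLinearMap)
      hmono x (by
        rw [top_le_iff, Submodule.topologicalClosure_eq_top_iff, Submodule.eq_bot_iff]
        intro w hw
        have hw0 (l : ℕ) : F l w = 0 := by
          rw [← inner_self_eq_zero (𝕜 := ℂ), inner_apply_comm (hF l).isSelfAdjoint, hself]
          exact (Submodule.mem_orthogonal' _ _).1 hw _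
            (Submodule.mem_iSup_of_mem l ⟨w, rfl⟩)
        have hlim := hp.tendsto_norm_sq w
        -- A vector killed by every `F N` has `‖P_N w‖² ≤ s ‖w‖²` for all `N`, while `‖P_N w‖ →
        -- ‖w‖`.
        refine eq_zero_of_norm_sq_le (s := s) (by linarith) (le_of_tendsto' hlim fun N => ?_)
        have := hclose N w
        rwa [hw0, zero_sub, norm_neg, hp.norm_partialSum_sq] at this)
    refine this.congr fun N => ?_
    exact (happ (hr N) x).symm
  have hqres : IsResolution q := by
    refine ⟨hqproj, fun n m hnm => ?_, fun x => (htend x).congr fun N => ?_⟩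
    · rcases lt_or_gt_of_ne hnm with h | h
      · exact hqlt n m h
      · have := congrArg star (hqlt m n h)
        rwa [star_mul, star_zero, (hqproj n).isSelfAdjoint.star_eq,
          (hqproj m).isSelfAdjoint.star_eq] at this
    · simp only [hqapp]
      rw [Finset.sum_range_sub (fun n => F n x), hF0]
      simp
  have hqG (n : ℕ) : PreservesGraph (perturb G V) (q n) := fun x y hxy =>
    (perturb G V).sub_mem (hFG (n + 1) x y hxy) (hFG n x y hxy)
  -- On the range of `q n` the cut at `n + 1` keeps at least `1 - s` of the squared norm and the cut
  -- at `n` at most `s`, so block `n` holds at least `1 - 2s`; the same with the roles exchanged.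
  obtain ⟨U, hU⟩ := exists_unitary_of_resolutions hG hV hp hqres hpG hqG
    (δ := 1 - 2 * s) (by linarith) (fun n x => by
      set z := q n x with hz
      have h1 : F (n + 1) z = z := by
        rw [hz, hqapp, map_sub, hself, ← mul_apply_eq_comp, hnested n (n + 1) n.le_succ]
      have h2 : F n z = 0 := by
        rw [hz, hqapp, map_sub, hself, ← mul_apply_eq_comp, hnested' n (n + 1) n.le_succ, sub_self]
      have h3 := hclose (n + 1) z
      have h4 := hclose n z
      rw [h1, norm_sub_apply_sq (hP _), hp.norm_partialSum_sq, Finset.sum_range_succ] at h3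
      rw [h2, zero_sub, norm_neg, hp.norm_partialSum_sq] at h4
      linarith) (fun n x => by
      set z := p n x with hz
      have h1 : partialSum p (n + 1) z = z := by
        rw [partialSum_apply, hz, Finset.sum_range_succ, hp.apply_self,
          Finset.sum_eq_zero fun m hm => hp.apply_of_ne (Finset.mem_range.1 hm).ne x, zero_add]
      have h2 : partialSum p n z = 0 := by
        rw [partialSum_apply]
        exact Finset.sum_eq_zero fun m hm => hp.apply_of_ne (Finset.mem_range.1 hm).ne x
      have h3 := hclose (n + 1) z
      have h4 := hclose n z
      rw [h1, norm_sub_rev, norm_sub_apply_sq (hF _)] at h3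
      rw [h2, sub_zero] at h4
      have h5 : ‖q n z‖ ^ 2 = ‖F (n + 1) z‖ ^ 2 - ‖F n z‖ ^ 2 := by
        have e : F n (F (n + 1) z) = F n z := happ (hnested' n (n + 1) n.le_succ) z
        rw [hqapp, ← e, norm_sub_apply_sq (hF n)]
      rw [h5]
      linarith)
  exact ⟨q, U, hqG, hU⟩

end Cuts

-- From the spectrum of a band to bounds on its quadratic form.

section Bands

/-- For `t < a` the resolvent `R = (A - t)⁻¹` is bounded and self-adjoint. It is also nonnegative,
so evaluating its form at `(A - t) x` gives the bound with `t`; then `t` tends to `a`. -/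
theorem le_re_inner_of_resolventSet {K : Type*} [NormedAddCommGroup K] [InnerProductSpace ℂ K]
    [CompleteSpace K] {A : K →ₗ.[ℂ] K}
    (hA : ∀ x y : A.domain, inner ℂ (A x) (y : K) = inner ℂ (x : K) (A y)) {a : ℝ}
    (h : ∀ t : ℝ, t < a → (t : ℂ) ∈ resolventSet A) (x : A.domain) :
    a * ‖(x : K)‖ ^ 2 ≤ (inner ℂ (A x) (x : K)).re := by
  have hpos (t : ℝ) (ht : t < a) : t * ‖(x : K)‖ ^ 2 ≤ (inner ℂ (A x) (x : K)).re := by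
    obtain ⟨R, hR, hR'⟩ := h t ht
    have hRs : IsSelfAdjoint R := by
      rw [ContinuousLinearMap.isSelfAdjoint_iff_isSymmetric]
      intro y z
      obtain ⟨hy, ey⟩ := hR y
      obtain ⟨hz, ez⟩ := hR z
      have := hA ⟨R y, hy⟩ ⟨R z, hz⟩
      calc inner ℂ (R y) z = inner ℂ (R y) (A ⟨R z, hz⟩ - (t : ℂ) • R z) := by rw [ez]
        _ = inner ℂ (A ⟨R y, hy⟩ - (t : ℂ) • R y) (R z) := by
          rw [inner_sub_left, inner_sub_right, this, inner_smul_left, inner_smul_right,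
            Complex.conj_ofReal]
        _ = inner ℂ y (R z) := by rw [ey]
    have hR0 : 0 ≤ R := by
      rw [StarOrderedRing.nonneg_iff_spectrum_nonneg (R := ℝ) R hRs]
      intro r hr
      by_contra hneg
      have hr0 : (r : ℂ) ≠ 0 := by
        rw [Complex.ofReal_ne_zero]; exact fun h0 => hneg h0.ge
      -- A spectral value `r < 0` of `R` would correspond to the point `t + 1/r < a` for `A`. The
      -- resolvent there provides an explicit inverse of `r - R`.
      obtain ⟨R₂, hR₂, hR₂'⟩ := h (t + 1 / r) (by
        have : 1 / r < 0 := one_div_neg.2 (not_le.1 hneg)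
        linarith)
      have e1 : R₂ - R = (r⁻¹ : ℂ) • (R * R₂) := by
        ext y
        obtain ⟨hy, ey⟩ := hR₂ y
        have h1 := hR' ⟨R₂ y, hy⟩
        have h2 : A ⟨R₂ y, hy⟩ - (t : ℂ) • R₂ y = y + (r⁻¹ : ℂ) • R₂ y := by
          nth_rewrite 3 [← ey]
          push_cast
          module
        simp only at h1
        rw [h2, map_add, map_smul] at h1
        rw [sub_apply, sub_eq_iff_eq_add']
        exact h1.symm
      have e2 : R₂ - R = (r⁻¹ : ℂ) • (R₂ * R) := by
        ext y
        obtain ⟨hy, ey⟩ := hR y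
        have h1 := hR₂' ⟨R y, hy⟩
        have h2 : A ⟨R y, hy⟩ - ((t + 1 / r : ℝ) : ℂ) • R y = y - (r⁻¹ : ℂ) • R y := by
          nth_rewrite 3 [← ey]
          push_cast
          module
        simp only at h1
        rw [h2, map_sub, map_smul, sub_eq_iff_eq_add] at h1
        rw [sub_apply, sub_eq_iff_eq_add']
        exact h1
      have e0 : (algebraMap ℝ (K →L[ℂ] K) r) = (r : ℂ) • (1 : K →L[ℂ] K) := rfl
      refine hr ?_
      rw [_root_.spectrum.mem_resolventSet_iff, e0]
      have hl : ((r : ℂ) • (1 : K →L[ℂ] K) - R) * ((r⁻¹ : ℂ) • (1 + (r⁻¹ : ℂ) • R₂)) = 1 := by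
        have e : ((r : ℂ) • (1 : K →L[ℂ] K) - R) * ((r⁻¹ : ℂ) • (1 + (r⁻¹ : ℂ) • R₂)) =
            1 + (r⁻¹ : ℂ) • (R₂ - R - (r⁻¹ : ℂ) • (R * R₂)) := by
          simp only [sub_mul, mul_smul_comm, mul_add, smul_mul_assoc, one_mul, mul_one]
          match_scalars <;> field_simp
        rw [e, ← e1, sub_self, smul_zero, add_zero]
      have hr' : ((r⁻¹ : ℂ) • (1 + (r⁻¹ : ℂ) • R₂)) * ((r : ℂ) • (1 : K →L[ℂ] K) - R) = 1 := by
        have e : ((r⁻¹ : ℂ) • (1 + (r⁻¹ : ℂ) • R₂)) * ((r : ℂ) • (1 : K →L[ℂ] K) - R) =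
            1 + (r⁻¹ : ℂ) • (R₂ - R - (r⁻¹ : ℂ) • (R₂ * R)) := by
          simp only [mul_sub, mul_smul_comm, add_mul, smul_mul_assoc, one_mul, mul_one]
          match_scalars <;> field_simp
        rw [e, ← e2, sub_self, smul_zero, add_zero]
      exact ⟨⟨_, _, hl, hr'⟩, rfl⟩
    have h1 := (nonneg_iff_re_inner.1 hR0).2 (A x - (t : ℂ) • (x : K))
    rw [hR', re_inner_comm, inner_sub_left, inner_smul_left, Complex.conj_ofReal, Complex.sub_re,
      Complex.re_ofReal_mul, re_inner_self] at h1
    linarith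
  have hlim : Tendsto (fun t : ℝ => t * ‖(x : K)‖ ^ 2) (𝓝[<] a) (𝓝 (a * ‖(x : K)‖ ^ 2)) :=
    ((continuous_id.mul continuous_const).tendsto a).mono_left nhdsWithin_le_nhds
  exact le_of_tendsto hlim (eventually_nhdsWithin_of_forall hpos)

theorem re_inner_le_of_resolventSet {K : Type*} [NormedAddCommGroup K] [InnerProductSpace ℂ K]
    [CompleteSpace K] {A : K →ₗ.[ℂ] K}
    (hA : ∀ x y : A.domain, inner ℂ (A x) (y : K) = inner ℂ (x : K) (A y)) {b : ℝ}
    (h : ∀ t : ℝ, b < t → (t : ℂ) ∈ resolventSet A) (x : A.domain) :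
    (inner ℂ (A x) (x : K)).re ≤ b * ‖(x : K)‖ ^ 2 := by
  have hneg (y : A.domain) : (-A) y = -A y := rfl
  have := le_re_inner_of_resolventSet (A := -A) (a := -b)
    (fun x y => by
      have := hA x y
      change inner ℂ (-A x) (y : K) = inner ℂ (x : K) (-A y)
      rw [inner_neg_left, inner_neg_right, this])
    (fun t ht => by
      obtain ⟨R, hR, hR'⟩ := h (-t) (by linarith)
      refine ⟨-R, fun y => ?_, fun y => ?_⟩
      · obtain ⟨hy, ey⟩ := hR y
        refine ⟨A.domain.neg_mem hy, ?_⟩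
        have e : (-A) ⟨-R y, A.domain.neg_mem hy⟩ = A ⟨R y, hy⟩ := by
          have : (⟨-R y, A.domain.neg_mem hy⟩ : A.domain) = -⟨R y, hy⟩ := rfl
          change -A ⟨-R y, A.domain.neg_mem hy⟩ = _
          rw [this, A.map_neg, neg_neg]
        refine Eq.trans ?_ ey
        change (-A) ⟨-R y, A.domain.neg_mem hy⟩ - _ • (-R y) = _
        rw [e]
        push_cast
        module
      · have h1 := hR' y
        change -R (-A y - (t : ℂ) • (y : K)) = y
        rw [← map_neg]
        nth_rewrite 2 [← h1]
        congr 1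
        push_cast
        module) x
  change -b * ‖(x : K)‖ ^ 2 ≤ (inner ℂ (-A x) (x : K)).re at this
  rw [inner_neg_left, Complex.neg_re] at this
  linarith

variable {E : Type*} [NormedAddCommGroup E] [InnerProductSpace ℂ E]

theorem preservesGraph_of_commutes {T : E →ₗ.[ℂ] E} {B : E →L[ℂ] E} (h : Commutes T B) :
    PreservesGraph T.graph B := by
  intro x y hxy
  obtain ⟨u, rfl, rfl⟩ := (LinearPMap.mem_graph_iff _).1 hxy
  obtain ⟨hu, e⟩ := h u
  exact (LinearPMap.mem_graph_iff _).2 ⟨⟨_, hu⟩, rfl, e⟩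

theorem graph_vadd (T : E →ₗ.[ℂ] E) (V : E →L[ℂ] E) :
    (V.toLinearMap +ᵥ T).graph = perturb T.graph V := by
  ext ⟨x, y⟩
  rw [mem_perturb, LinearPMap.mem_graph_iff, LinearPMap.mem_graph_iff]
  constructor
  · rintro ⟨u, hu, e⟩
    refine ⟨u, hu, ?_⟩
    simp only at hu e ⊢
    rw [← e, ← hu]
    change T u = V u + T u - V u
    rw [add_sub_cancel_left]
  · rintro ⟨u, hu, e⟩
    refine ⟨u, hu, ?_⟩
    simp only at hu e ⊢
    change V u + T u = y
    rw [e, hu, add_sub_cancel]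

variable [CompleteSpace E]

theorem inner_comm_of_isSelfAdjoint {H : E →ₗ.[ℂ] E} (hH : IsSelfAdjoint H) (x y : H.domain) :
    inner ℂ (H x) (y : E) = inner ℂ (x : E) (H y) := by
  have h := LinearPMap.adjoint_isFormalAdjoint hH.dense_domain
  have e : H.adjoint = H := hH
  rw [e] at h
  exact h x y

theorem adjoint_graph_of_isSelfAdjoint {H : E →ₗ.[ℂ] E} (hH : IsSelfAdjoint H) :
    H.graph.adjoint = H.graph := by
  rw [← LinearPMap.adjoint_graph_eq_graph_adjoint hH.dense_domain]
  have e : H.adjoint = H := hH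
  rw [e]

theorem completeSpace_range {P : E →L[ℂ] E} (hP : IsStarProjection P) :
    CompleteSpace (LinearMap.range P.toLinearMap) := by
  have : IsClosed ((LinearMap.range P.toLinearMap : Submodule ℂ E) : Set E) :=
    ContinuousLinearMap.IsIdempotentElem.isClosed_range hP.isIdempotentElem
  exact this.completeSpace_coe

theorem compression_symm {H : E →ₗ.[ℂ] E} (hH : IsSelfAdjoint H) {P : E →L[ℂ] E}
    (hP : IsStarProjection P) (x y : (compression H P).domain) :
    inner ℂ (compression H P x) (y : LinearMap.range P.toLinearMap) =
      inner ℂ (x : LinearMap.range P.toLinearMap) (compression H P y) := by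
  have hfix (z : LinearMap.range P.toLinearMap) : P (z : E) = z := by
    obtain ⟨w, hw⟩ := z.2
    rw [← hw]
    exact congrArg (fun T : E →L[ℂ] E => T w) hP.isIdempotentElem.eq
  have h := inner_comm_of_isSelfAdjoint hH ⟨_, x.2⟩ ⟨_, y.2⟩
  change inner ℂ (P (H ⟨_, x.2⟩)) ((y : LinearMap.range P.toLinearMap) : E) =
    inner ℂ ((x : LinearMap.range P.toLinearMap) : E) (P (H ⟨_, y.2⟩))
  rw [inner_apply_comm hP.isSelfAdjoint, hfix, ← inner_apply_comm hP.isSelfAdjoint, hfix]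
  exact h

theorem le_re_inner_of_band {H : E →ₗ.[ℂ] E} (hH : IsSelfAdjoint H) {P : E →L[ℂ] E}
    (hP : IsStarProjection P) (hHP : PreservesGraph H.graph P) {a : ℝ}
    (ha : a ∈ lowerBounds (band H P)) {x y : E} (hxy : (x, y) ∈ H.graph) :
    a * ‖P x‖ ^ 2 ≤ (inner ℂ (P x) (P y)).re := by
  have := completeSpace_range hP
  obtain ⟨⟨u, hu⟩, hu1, hu2⟩ := (LinearPMap.mem_graph_iff _).1 (hHP x y hxy)
  simp only at hu1 hu2
  subst hu1
  have h := le_re_inner_of_resolventSet (compression_symm hH hP) (a := a) (fun t ht => by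
    by_contra hn
    exact absurd (ha (show t ∈ band H P from hn)) (not_le.2 ht))
    ⟨⟨P x, LinearMap.mem_range_self P.toLinearMap x⟩, hu⟩
  have hPP (z : E) : P (P z) = P z :=
    congrArg (fun T : E →L[ℂ] E => T z) hP.isIdempotentElem.eq
  change a * ‖P x‖ ^ 2 ≤ (inner ℂ (P (H ⟨P x, hu⟩)) (P x)).re at h
  rwa [hu2, hPP, re_inner_comm] at h

theorem re_inner_le_of_band {H : E →ₗ.[ℂ] E} (hH : IsSelfAdjoint H) {P : E →L[ℂ] E}
    (hP : IsStarProjection P) (hHP : PreservesGraph H.graph P) {b : ℝ}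
    (hb : b ∈ upperBounds (band H P)) {x y : E} (hxy : (x, y) ∈ H.graph) :
    (inner ℂ (P x) (P y)).re ≤ b * ‖P x‖ ^ 2 := by
  have := completeSpace_range hP
  obtain ⟨⟨u, hu⟩, hu1, hu2⟩ := (LinearPMap.mem_graph_iff _).1 (hHP x y hxy)
  simp only at hu1 hu2
  subst hu1
  have h := re_inner_le_of_resolventSet (compression_symm hH hP) (b := b) (fun t ht => by
    by_contra hn
    exact absurd (hb (show t ∈ band H P from hn)) (not_le.2 ht))
    ⟨⟨P x, LinearMap.mem_range_self P.toLinearMap x⟩, hu⟩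
  have hPP (z : E) : P (P z) = P z :=
    congrArg (fun T : E →L[ℂ] E => T z) hP.isIdempotentElem.eq
  change (inner ℂ (P (H ⟨P x, hu⟩)) (P x)).re ≤ b * ‖P x‖ ^ 2 at h
  rwa [hu2, hPP, re_inner_comm] at h

end Bands

-- A weighted Schur test with explicit constants.

section Schur

/-- `φ` is a discrete primitive dominating `f`; an explicit one bounds sums over all of `ℤ` without
evaluating series. -/
theorem sum_le_of_telescoping {f φ : ℤ → ℝ} {B : ℝ} (hf : ∀ j, 0 ≤ f j)
    (hφ : ∀ j, f j ≤ φ (j + 1) - φ j) (h0 : ∀ j, 0 ≤ φ j) (hB : ∀ j, φ j ≤ B) (S : Finset ℤ) :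
    ∑ j ∈ S, f j ≤ B := by
  have hIco (a : ℤ) (n : ℕ) : ∑ j ∈ Finset.Ico a (a + n), f j ≤ φ (a + n) - φ a := by
    induction n with
    | zero => simp
    | succ n ih =>
      have : Finset.Ico a (a + (n + 1 : ℕ)) = insert (a + n) (Finset.Ico a (a + n)) := by
        ext j; simp only [Finset.mem_Ico, Finset.mem_insert]; push_cast; lia
      rw [this, Finset.sum_insert (by simp)]
      have := hφ (a + n)
      push_cast
      rw [← add_assoc]
      linarith
  set N := S.sup Int.natAbs with hN
  have hsub : S ⊆ Finset.Ico (-(N : ℤ)) (-(N : ℤ) + (2 * N + 1 : ℕ)) := by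
    intro j hj
    have : j.natAbs ≤ N := Finset.le_sup (f := Int.natAbs) hj
    simp only [Finset.mem_Ico]
    push_cast
    lia
  calc ∑ j ∈ S, f j ≤ _ := Finset.sum_le_sum_of_subset_of_nonneg hsub fun j _ _ => hf j
    _ ≤ _ := hIco _ _
    _ ≤ B := by linarith [hB (-(N : ℤ) + (2 * N + 1 : ℕ)), h0 (-(N : ℤ))]

theorem sum_inv_max_sq_le (S : Finset ℤ) : ∑ j ∈ S, (1 / max 1 |(j : ℝ)|) ^ 2 ≤ 5 := by
  refine sum_le_of_telescoping (φ := fun j => if 2 ≤ j then 5 - 1 / ((j : ℝ) - 1) else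
    if j = 1 then 3 else if j = 0 then 2 else 1 / (-(j : ℝ))) (fun j => by positivity)
    (fun j => ?_) (fun j => ?_) (fun j => ?_) S
  · rcases lt_trichotomy j 0 with h | h | h
    · rcases eq_or_lt_of_le (show j ≤ -1 by lia) with rfl | h'
      · norm_num
      · have hj : (j : ℝ) ≤ -2 := by exact_mod_cast (show j ≤ -2 by lia)
        rw [if_neg (by lia), if_neg (by lia), if_neg (by lia), if_neg (by lia), if_neg (by lia),
          if_neg (by lia), max_eq_right (by rw [abs_of_neg (by linarith)]; linarith), div_pow,
          sq_abs]
        push_cast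
        have h1 : 0 < -(j + 1 : ℝ) := by linarith
        have h2 : 0 < -(j : ℝ) := by linarith
        have h3 : 1 / -((j : ℝ) + 1) - 1 / -(j : ℝ) = 1 / ((j : ℝ) * (j + 1)) := by
          have : (j : ℝ) ≠ 0 := by linarith
          have : (j : ℝ) + 1 ≠ 0 := by linarith
          field_simp
          ring
        rw [h3, one_pow]
        exact one_div_le_one_div_of_le (by nlinarith) (by nlinarith)
    · subst h; norm_num
    · rcases eq_or_lt_of_le (show 1 ≤ j by lia) with rfl | h'
      · norm_num
      · have hj : (2 : ℝ) ≤ j := by exact_mod_cast (show 2 ≤ j by lia)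
        rw [if_pos (by lia), if_pos (by lia), max_eq_right (by
          rw [abs_of_pos (by linarith)]; linarith), div_pow, sq_abs]
        push_cast
        have h3 : 5 - 1 / ((j : ℝ) + 1 - 1) - (5 - 1 / ((j : ℝ) - 1)) =
            1 / ((j : ℝ) * (j - 1)) := by
          have : (j : ℝ) ≠ 0 := by linarith
          have : (j : ℝ) - 1 ≠ 0 := by linarith
          rw [add_sub_cancel_right]
          field_simp
          ring
        rw [h3, one_pow]
        exact one_div_le_one_div_of_le (by nlinarith) (by nlinarith)
  · split_ifs with h1 h2 h3
    · have hj : (2 : ℝ) ≤ j := by exact_mod_cast h1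
      have : 1 / ((j : ℝ) - 1) ≤ 1 := by rw [div_le_one (by linarith)]; linarith
      linarith
    · norm_num
    · norm_num
    · have hj : (j : ℝ) ≤ -1 := by exact_mod_cast (show j ≤ -1 by lia)
      exact one_div_nonneg.2 (by linarith)
  · split_ifs with h1 h2 h3
    · have hj : (2 : ℝ) ≤ j := by exact_mod_cast h1
      have : 0 ≤ 1 / ((j : ℝ) - 1) := one_div_nonneg.2 (by linarith)
      linarith
    · norm_num
    · norm_num
    · have hj : (j : ℝ) ≤ -1 := by exact_mod_cast (show j ≤ -1 by lia)
      have : 1 / (-(j : ℝ)) ≤ 1 := by rw [div_le_one (by linarith)]; linarith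
      linarith

/-- The full series equals `π² / 4 ≈ 2.47`, so there is little slack. The primitive comes from `(2j
+ 1)² ≥ 4 j (j + 1)`, with the term `j = 0` kept exact. -/
theorem sum_inv_odd_sq_le (S : Finset ℤ) : ∑ j ∈ S, (1 / |2 * (j : ℝ) + 1|) ^ 2 ≤ 5 / 2 := by
  refine sum_le_of_telescoping (φ := fun j => if 1 ≤ j then 5 / 2 - 1 / (4 * (j : ℝ)) else
    if j = 0 then 5 / 4 else 1 / (4 * (-(j : ℝ)))) (fun j => by positivity)
    (fun j => ?_) (fun j => ?_) (fun j => ?_) S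
  · rw [div_pow, sq_abs, one_pow]
    rcases lt_trichotomy j 0 with h | h | h
    · rcases eq_or_lt_of_le (show j ≤ -1 by lia) with rfl | h'
      · norm_num
      · have hj : (j : ℝ) ≤ -2 := by exact_mod_cast (show j ≤ -2 by lia)
        rw [if_neg (by lia), if_neg (by lia), if_neg (by lia), if_neg (by lia)]
        push_cast
        have h3 : 1 / (4 * -((j : ℝ) + 1)) - 1 / (4 * -(j : ℝ)) =
            1 / (4 * ((j : ℝ) * (j + 1))) := by
          have : (j : ℝ) ≠ 0 := by linarith
          have : (j : ℝ) + 1 ≠ 0 := by linarith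
          field_simp
          ring
        rw [h3]
        exact one_div_le_one_div_of_le (by nlinarith) (by nlinarith)
    · subst h; norm_num
    · have hj : (1 : ℝ) ≤ j := by exact_mod_cast (show 1 ≤ j by lia)
      rw [if_pos (by lia), if_pos (by lia)]
      push_cast
      have h3 : 5 / 2 - 1 / (4 * ((j : ℝ) + 1)) - (5 / 2 - 1 / (4 * (j : ℝ))) =
          1 / (4 * ((j : ℝ) * (j + 1))) := by
        have : (j : ℝ) ≠ 0 := by linarith
        have : (j : ℝ) + 1 ≠ 0 := by linarith
        field_simp
        ring
      rw [h3]
      exact one_div_le_one_div_of_le (by nlinarith) (by nlinarith)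
  · split_ifs with h1 h2
    · have hj : (1 : ℝ) ≤ j := by exact_mod_cast h1
      have : 1 / (4 * (j : ℝ)) ≤ 1 := by rw [div_le_one (by linarith)]; linarith
      linarith
    · norm_num
    · have hj : (j : ℝ) ≤ -1 := by exact_mod_cast (show j ≤ -1 by lia)
      exact one_div_nonneg.2 (by linarith)
  · split_ifs with h1 h2
    · have hj : (1 : ℝ) ≤ j := by exact_mod_cast h1
      have : 0 ≤ 1 / (4 * (j : ℝ)) := one_div_nonneg.2 (by linarith)
      linarith
    · norm_num
    · have hj : (j : ℝ) ≤ -1 := by exact_mod_cast (show j ≤ -1 by lia)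
      have : 1 / (4 * (-(j : ℝ))) ≤ 1 := by rw [div_le_one (by linarith)]; linarith
      linarith

theorem one_le_abs_odd (j : ℤ) : (1 : ℝ) ≤ |2 * (j : ℝ) + 1| := by
  have : (1 : ℤ) ≤ |2 * j + 1| := Int.one_le_abs (by lia)
  exact_mod_cast this

/-- A Schur test for the matrix `1 / max 1 |i - j|` against the diagonal `|2 i + 1|`. -/
theorem schur_bound {ι : Type*} (S : Finset ι) (c : ι → ℤ) (hc : Set.InjOn c S) (x : ι → ℝ) :
    ∑ n ∈ S, ∑ m ∈ S, 1 / max 1 |(c n : ℝ) - c m| * (|x n| * |x m|) ≤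
      15 / 4 * ∑ n ∈ S, |2 * (c n : ℝ) + 1| * x n ^ 2 := by
  classical
  set κ : ι → ι → ℝ := fun n m => 1 / max 1 |(c n : ℝ) - c m| with hκ
  set d : ι → ℝ := fun n => |2 * (c n : ℝ) + 1| with hd
  have hd1 (n : ι) : 1 ≤ d n := one_le_abs_odd (c n)
  have hd0 (n : ι) : 0 < d n := one_pos.trans_le (hd1 n)
  have hκ0 (n m : ι) : 0 ≤ κ n m := by positivity
  have hsymm (n m : ι) : κ n m = κ m n := by simp only [hκ, abs_sub_comm]
  -- By `ab ≤ (a² + b²)/2` the row sum is at most `(5 + 5/2)/2 = 15/4`. The weight `1 / d` supplies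
  -- the decay that `κ` alone lacks.
  have hrow (n : ι) : ∑ m ∈ S, κ n m * (1 / d m) ≤ 15 / 4 := by
    have h1 : ∑ m ∈ S, κ n m ^ 2 ≤ 5 := by
      have hinj : Set.InjOn (fun m => c m - c n) S := fun a ha b hb hab =>
        hc ha hb (sub_left_injective hab)
      have := sum_inv_max_sq_le (S.image fun m => c m - c n)
      rw [Finset.sum_image hinj] at this
      refine le_trans (le_of_eq (Finset.sum_congr rfl fun m _ => ?_)) this
      rw [hsymm]
      simp [hκ]
    have h2 : ∑ m ∈ S, (1 / d m) ^ 2 ≤ 5 / 2 := by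
      have := sum_inv_odd_sq_le (S.image c)
      rwa [Finset.sum_image hc] at this
    have h3 : ∑ m ∈ S, κ n m * (1 / d m) ≤ ∑ m ∈ S, (κ n m ^ 2 + (1 / d m) ^ 2) / 2 :=
      Finset.sum_le_sum fun m _ => by nlinarith [sq_nonneg (κ n m - 1 / d m)]
    rw [← Finset.sum_div, Finset.sum_add_distrib] at h3
    linarith
  have hterm (n m : ι) : κ n m * (|x n| * |x m|) ≤
      (κ n m * (1 / d m) * (d n * x n ^ 2) + κ m n * (1 / d n) * (d m * x m ^ 2)) / 2 := by
    have hn := hd0 n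
    have hm := hd0 m
    rw [hsymm m n]
    have e : (κ n m * (1 / d m) * (d n * x n ^ 2) + κ n m * (1 / d n) * (d m * x m ^ 2)) / 2 -
        κ n m * (|x n| * |x m|) = κ n m * (d n * |x n| - d m * |x m|) ^ 2 / (2 * d n * d m) := by
      rw [← sq_abs (x n), ← sq_abs (x m)]
      field_simp
      ring
    have : 0 ≤ κ n m * (d n * |x n| - d m * |x m|) ^ 2 / (2 * d n * d m) := by positivity
    linarith
  have hsum : ∑ n ∈ S, ∑ m ∈ S, κ n m * (1 / d m) * (d n * x n ^ 2) ≤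
      15 / 4 * ∑ n ∈ S, d n * x n ^ 2 := by
    rw [Finset.mul_sum]
    refine Finset.sum_le_sum fun n _ => ?_
    rw [← Finset.sum_mul]
    exact mul_le_mul_of_nonneg_right (hrow n) (mul_nonneg (hd0 n).le (sq_nonneg _))
  calc _ ≤ ∑ n ∈ S, ∑ m ∈ S,
        (κ n m * (1 / d m) * (d n * x n ^ 2) + κ m n * (1 / d n) * (d m * x m ^ 2)) / 2 :=
      Finset.sum_le_sum fun n _ => Finset.sum_le_sum fun m _ => hterm n m
    _ = (∑ n ∈ S, ∑ m ∈ S, κ n m * (1 / d m) * (d n * x n ^ 2) +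
        ∑ n ∈ S, ∑ m ∈ S, κ m n * (1 / d n) * (d m * x m ^ 2)) / 2 := by
      simp only [← Finset.sum_div, Finset.sum_add_distrib]
    _ = ∑ n ∈ S, ∑ m ∈ S, κ n m * (1 / d m) * (d n * x n ^ 2) := by
      rw [Finset.sum_comm (f := fun n m => κ m n * (1 / d n) * (d m * x m ^ 2))]
      ring
    _ ≤ _ := hsum

end Schur

-- The form bound for `H + V` at a cut.

section CutBound

variable {E : Type*} [NormedAddCommGroup E] [InnerProductSpace ℂ E] [CompleteSpace E]

/-- Reflecting a block through a cut multiplies it by a sign. -/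
theorem IsResolution.reflect_apply {p : ℕ → E →L[ℂ] E} (hp : IsResolution p) (k n : ℕ) (x : E) :
    p n x - (2 : ℂ) • partialSum p k (p n x) = ((if n < k then -1 else 1 : ℝ) : ℂ) • p n x := by
  rw [partialSum_apply]
  split_ifs with h
  · rw [Finset.sum_eq_single n (fun m _ hm => hp.apply_of_ne hm x)
      (fun hn => absurd (Finset.mem_range.2 h) hn), hp.apply_self]
    push_cast
    module
  · rw [Finset.sum_eq_zero fun m hm => hp.apply_of_ne
      ((Finset.mem_range.1 hm).trans_le (not_lt.1 h)).ne x]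
    simp

theorem IsResolution.partialSum_commute {p : ℕ → E →L[ℂ] E} (hp : IsResolution p) (n : ℕ) (x : E)
    {N : ℕ} (hn : n < N) : p n (partialSum p N x) = p n x := by
  rw [partialSum_apply]
  exact hp.apply_sum_range hn fun _ => x

/-- If `±(T - μ)` is bounded below on the blocks above and below a cut proportionally to the
distance from the cut, then so is `±(T + V - μ)` on the two sides of the cut. -/
theorem cut_bound {p : ℕ → E →L[ℂ] E} (hp : IsResolution p) {I : Set ℕ}
    (hpI : ∀ n, n ∉ I → p n = 0) {c : ℕ → ℤ} (hc : Set.InjOn c I) {V : E →L[ℂ] E} {g : ℝ}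
    (hg : 0 ≤ g)
    (hVg : ∀ n m, ‖p n * V * p m‖ ≤ g / 8 * (1 / max 1 |(c n : ℝ) - c m|)) {k : ℕ} {μ : ℝ}
    {x y : E} (hgap : ∀ n, g * (|2 * (c n : ℝ) + 1| / 2) * ‖p n x‖ ^ 2 ≤
      (if n < k then -1 else 1 : ℝ) * (inner ℂ (p n x) (p n (y - (μ : ℂ) • x))).re) :
    g / 32 * ‖x‖ ^ 2 ≤
      (inner ℂ (x - (2 : ℂ) • partialSum p k x) (y + V x - (μ : ℂ) • x)).re := by
  classical
  set σ : ℕ → ℝ := fun n => if n < k then -1 else 1 with hσ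
  have hσ1 (n : ℕ) : |σ n| = 1 := by simp only [hσ]; split_ifs <;> simp
  set z := y - (μ : ℂ) • x with hz
  have happ {A B : E →L[ℂ] E} (h : A = B) (x : E) : A x = B x := congrArg (fun T => T x) h
  -- The estimate is proved on finitely many blocks and passed to the limit through bounded
  -- operators only; `T` enters just through the vector `z`.
  have hN (N : ℕ) : g / 32 * ‖partialSum p N x‖ ^ 2 ≤
      (inner ℂ (partialSum p N x - (2 : ℂ) • partialSum p k (partialSum p N x))
        (partialSum p N z + V (partialSum p N x))).re := by
    have hrefl : partialSum p N x - (2 : ℂ) • partialSum p k (partialSum p N x) =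
        ∑ n ∈ Finset.range N, ((σ n : ℝ) : ℂ) • p n x := by
      rw [partialSum_apply p N, map_sum, Finset.smul_sum, ← Finset.sum_sub_distrib]
      exact Finset.sum_congr rfl fun n _ => hp.reflect_apply k n x
    rw [hrefl, inner_add_right, Complex.add_re, sum_inner, sum_inner, Complex.re_sum,
      Complex.re_sum]
    have h1 (n : ℕ) (hn : n ∈ Finset.range N) : g * (|2 * (c n : ℝ) + 1| / 2) * ‖p n x‖ ^ 2 ≤
        (inner ℂ (((σ n : ℝ) : ℂ) • p n x) (partialSum p N z)).re := by
      rw [inner_smul_left, Complex.conj_ofReal, Complex.re_ofReal_mul, ← hp.apply_self n x,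
        inner_apply_comm (hp.proj n).isSelfAdjoint,
        hp.partialSum_commute n z (Finset.mem_range.1 hn), hp.apply_self]
      exact hgap n
    have h2 (n : ℕ) : -(g / 8 * ∑ m ∈ Finset.range N,
          1 / max 1 |(c n : ℝ) - c m| * (|‖p n x‖| * |‖p m x‖|)) ≤
        (inner ℂ (((σ n : ℝ) : ℂ) • p n x) (V (partialSum p N x))).re := by
      rw [inner_smul_left, Complex.conj_ofReal, Complex.re_ofReal_mul, partialSum_apply, map_sum,
        inner_sum, Complex.re_sum]
      refine neg_le_of_abs_le ?_
      rw [abs_mul, hσ1, one_mul, Finset.mul_sum]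
      refine (Finset.abs_sum_le_sum_abs _ _).trans (Finset.sum_le_sum fun m _ => ?_)
      rw [abs_norm, abs_norm]
      have e : inner ℂ (p n x) (V (p m x)) = inner ℂ (p n x) ((p n * V * p m) (p m x)) := by
        rw [mul_apply_eq_comp, mul_apply_eq_comp, ← inner_apply_comm (hp.proj n).isSelfAdjoint,
          hp.apply_self, hp.apply_self]
      rw [e]
      calc _ ≤ ‖p n x‖ * (‖p n * V * p m‖ * ‖p m x‖) :=
            (Complex.abs_re_le_norm _).trans ((norm_inner_le_norm _ _).trans
              (mul_le_mul_of_nonneg_left (ContinuousLinearMap.le_opNorm _ _) (norm_nonneg _)))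
        _ ≤ ‖p n x‖ * (g / 8 * (1 / max 1 |(c n : ℝ) - c m|) * ‖p m x‖) := by
            gcongr; exact hVg n m
        _ = _ := by ring
    -- `c` is injective only on `I`, as the Schur test requires; blocks outside `I` vanish.
    set S := (Finset.range N).filter (· ∈ I) with hS
    have hzero (n : ℕ) (hn : n ∈ Finset.range N) (hnS : n ∉ S) : p n x = 0 := by
      rw [hpI n fun h => hnS (Finset.mem_filter.2 ⟨hn, h⟩)]; rfl
    have hsch := schur_bound S c (fun a ha b hb hab =>
      hc (Finset.mem_filter.1 ha).2 (Finset.mem_filter.1 hb).2 hab) fun n => ‖p n x‖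
    have hSsub : S ⊆ Finset.range N := Finset.filter_subset _ _
    have h3 : ∑ n ∈ S, ∑ m ∈ S, 1 / max 1 |(c n : ℝ) - c m| * (|‖p n x‖| * |‖p m x‖|) =
        ∑ n ∈ Finset.range N, ∑ m ∈ Finset.range N,
          1 / max 1 |(c n : ℝ) - c m| * (|‖p n x‖| * |‖p m x‖|) := by
      rw [← Finset.sum_subset hSsub fun n hn hnS => ?_]
      · refine Finset.sum_congr rfl fun n _ => Finset.sum_subset hSsub fun m hm hmS => ?_
        rw [hzero m hm hmS]; simp
      · rw [hzero n hn hnS]; simp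
    have h4 : ∑ n ∈ S, |2 * (c n : ℝ) + 1| * ‖p n x‖ ^ 2 =
        ∑ n ∈ Finset.range N, |2 * (c n : ℝ) + 1| * ‖p n x‖ ^ 2 :=
      Finset.sum_subset hSsub fun n hn hnS => by rw [hzero n hn hnS]; simp
    rw [h3, h4] at hsch
    have h5 := Finset.sum_le_sum h1
    have h6 := Finset.sum_le_sum fun n (_ : n ∈ Finset.range N) => h2 n
    rw [Finset.sum_neg_distrib, ← Finset.mul_sum] at h6
    have h7 : ∑ n ∈ Finset.range N, g * (|2 * (c n : ℝ) + 1| / 2) * ‖p n x‖ ^ 2 =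
        g / 2 * ∑ n ∈ Finset.range N, |2 * (c n : ℝ) + 1| * ‖p n x‖ ^ 2 := by
      rw [Finset.mul_sum]
      exact Finset.sum_congr rfl fun n _ => by ring
    rw [h7] at h5
    have h8 : ∑ n ∈ Finset.range N, ‖p n x‖ ^ 2 ≤
        ∑ n ∈ Finset.range N, |2 * (c n : ℝ) + 1| * ‖p n x‖ ^ 2 :=
      Finset.sum_le_sum fun n _ => le_mul_of_one_le_left (sq_nonneg _) (one_le_abs_odd (c n))
    rw [hp.norm_partialSum_sq]
    -- The balance: `g/2` from the gaps against `(g/8)(15/4) = 15g/32` from `V` leaves `g/32`.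
    have h9 := mul_le_mul_of_nonneg_left hsch (show 0 ≤ g / 8 by positivity)
    have h10 := mul_le_mul_of_nonneg_left h8 (show 0 ≤ g / 32 by positivity)
    linarith
  have ht (w : E) : Tendsto (fun N => partialSum p N w) atTop (𝓝 w) :=
    (hp.tendsto w).congr fun N => (partialSum_apply p N w).symm
  have hcont : Continuous fun q : E × E =>
      (inner ℂ (q.1 - (2 : ℂ) • partialSum p k q.1) (q.2 + V q.1)).re := by fun_prop
  have hlim := (hcont.tendsto (x, z)).comp ((ht x).prodMk_nhds (ht z))
  have hlim2 := ((ht x).norm.pow 2).const_mul (g / 32)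
  have := le_of_tendsto_of_tendsto' hlim2 hlim hN
  simp only at this
  rwa [show y + V x - (μ : ℂ) • x = z + V x by rw [hz]; abel]

end CutBound

-- Ranks in an index set with holes.

section Ranks

open Classical in
/-- The rank of `n` in `I`. -/
noncomputable def rank (I : Set ℕ) (n : ℕ) : ℕ := Nat.count (· ∈ I) n

variable {I : Set ℕ}

theorem rank_mono : Monotone (rank I) := by classical exact Nat.count_monotone _

theorem rank_succ_of_mem {n : ℕ} (hn : n ∈ I) : rank I (n + 1) = rank I n + 1 := by
  classical
  simp [rank, Nat.count_succ, hn]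

theorem rank_add_le (n d : ℕ) : rank I (n + d) ≤ rank I n + d := by
  classical
  induction d with
  | zero => simp
  | succ d ih =>
    have : rank I (n + d + 1) ≤ rank I (n + d) + 1 := by
      simp only [rank, Nat.count_succ]; split_ifs <;> simp
    rw [← add_assoc]
    lia

theorem rank_injOn : Set.InjOn (rank I) I := by
  intro a ha b hb hab
  by_contra hne
  rcases lt_or_gt_of_ne hne with h | h
  · have := rank_mono (I := I) (Nat.succ_le_of_lt h)
    rw [Nat.succ_eq_add_one, rank_succ_of_mem ha] at this
    lia
  · have := rank_mono (I := I) (Nat.succ_le_of_lt h)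
    rw [Nat.succ_eq_add_one, rank_succ_of_mem hb] at this
    lia

/-- Removing holes only shrinks distances, so decay of `V` in the index difference implies decay in
the rank difference, the scale on which the bands separate. -/
theorem abs_rank_sub_le (n m : ℕ) : |(rank I n : ℝ) - rank I m| ≤ |(n : ℝ) - m| := by
  wlog h : m ≤ n generalizing n m
  · rw [abs_sub_comm, abs_sub_comm (n : ℝ)]
    exact this m n (le_of_not_ge h)
  obtain ⟨d, rfl⟩ := Nat.exists_eq_add_of_le h
  have h1 := rank_add_le (I := I) m d
  have h2 := rank_mono (I := I) h
  rw [abs_of_nonneg (sub_nonneg.2 (by exact_mod_cast h2)),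
    abs_of_nonneg (sub_nonneg.2 (by exact_mod_cast h))]
  have h1' : (rank I (m + d) : ℝ) ≤ rank I m + d := by exact_mod_cast h1
  push_cast
  linarith

theorem exists_covBy_of_cut {k : ℕ} (h1 : ∃ n : I, (n : ℕ) < k) (h2 : ∃ n : I, k ≤ (n : ℕ)) :
    ∃ n m : I, n ⋖ m ∧ (n : ℕ) < k ∧ k ≤ (m : ℕ) := by
  classical
  obtain ⟨a, ha⟩ := h1
  obtain ⟨b, hb⟩ := h2
  have hne : ((Finset.range k).filter (· ∈ I)).Nonempty :=
    ⟨a, Finset.mem_filter.2 ⟨Finset.mem_range.2 ha, a.2⟩⟩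
  have hex : ∃ m, m ∈ I ∧ k ≤ m := ⟨b, b.2, hb⟩
  have hmax := Finset.max'_mem _ hne
  set n := ((Finset.range k).filter (· ∈ I)).max' hne with hn
  rw [Finset.mem_filter, Finset.mem_range] at hmax
  refine ⟨⟨n, hmax.2⟩, ⟨Nat.find hex, (Nat.find_spec hex).1⟩, ⟨?_, ?_⟩, hmax.1,
    (Nat.find_spec hex).2⟩
  · exact Subtype.mk_lt_mk.2 (hmax.1.trans_le (Nat.find_spec hex).2)
  · rintro ⟨j, hj⟩ hnj hjm
    rw [Subtype.mk_lt_mk] at hnj hjm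
    rcases lt_or_ge j k with hjk | hjk
    · have := Finset.le_max' _ j (Finset.mem_filter.2 ⟨Finset.mem_range.2 hjk, hj⟩)
      lia
    · exact Nat.find_min hex hjm ⟨hj, hjk⟩

theorem le_of_covBy_of_lt {n m j : I} (h : n ⋖ m) (hj : n < j) : m ≤ j :=
  not_lt.1 fun hjm => h.2 hj hjm

theorem rank_of_covBy {n m : I} (h : n ⋖ m) {k : ℕ} (hnk : (n : ℕ) < k) (hkm : k ≤ (m : ℕ)) :
    rank I k = rank I n + 1 := by
  classical
  have key (d : ℕ) (hd : (n : ℕ) + 1 + d ≤ m) : rank I (n + 1 + d) = rank I n + 1 := by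
    induction d with
    | zero => exact rank_succ_of_mem n.2
    | succ d ih =>
      have hnot : (n : ℕ) + 1 + d ∉ I := fun hmem => by
        have h1 : n < ⟨_, hmem⟩ := Subtype.mk_lt_mk.2 (show (n : ℕ) < n + 1 + d by lia)
        have h2 : (⟨_, hmem⟩ : I) < m := Subtype.mk_lt_mk.2 (show (n : ℕ) + 1 + d < m by lia)
        exact h.2 h1 h2
      have h3 := ih (by lia)
      rw [← h3]
      simp only [rank]
      rw [← add_assoc, Nat.count_succ, if_neg hnot, add_zero]
  obtain ⟨d, rfl⟩ := Nat.exists_eq_add_of_le (show (n : ℕ) + 1 ≤ k from hnk)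
  exact key d hkm

end Ranks

-- The cuts of an operator of class `𝒞_g`, and the theorem.

section Main

variable {E : Type*} [NormedAddCommGroup E] [InnerProductSpace ℂ E]

open Classical in
/-- The family `P`, extended by zero to all natural numbers. -/
noncomputable def extend {I : Set ℕ} (P : I → E →L[ℂ] E) (n : ℕ) : E →L[ℂ] E :=
  if h : n ∈ I then P ⟨n, h⟩ else 0

theorem extend_coe {I : Set ℕ} (P : I → E →L[ℂ] E) (n : I) : extend P n = P n := by
  rw [extend, dif_pos n.2]

theorem extend_of_notMem {I : Set ℕ} (P : I → E →L[ℂ] E) {n : ℕ} (hn : n ∉ I) :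
    extend P n = 0 := dif_neg hn

theorem PreservesGraph.partialSum {G : Submodule ℂ (E × E)} {p : ℕ → E →L[ℂ] E}
    (h : ∀ n, PreservesGraph G (p n)) (k : ℕ) : PreservesGraph G (partialSum p k) := by
  intro x y hxy
  have := G.sum_mem (t := Finset.range k) fun n _ => h n x y hxy
  rw [partialSum_apply, partialSum_apply]
  convert this using 1
  simp [Prod.ext_iff, Prod.fst_sum, Prod.snd_sum]

theorem block_norm_le {I : Set ℕ} {P : I → E →L[ℂ] E} {V : E →L[ℂ] E} {g : ℝ} (hg : 0 < g)
    (hVg : blockNorm P 1 V ≤ ENNReal.ofReal (g / 8)) (k : ℕ) (n m : ℕ) :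
    ‖extend P n * V * extend P m‖ ≤ g / 8 *
      (1 / max 1 |((((rank I n : ℤ) - rank I k : ℤ)) : ℝ) - (((rank I m : ℤ) - rank I k : ℤ))|) := by
  by_cases hn : n ∈ I
  · by_cases hm : m ∈ I
    · have h1 := (le_iSup₂ (f := fun n m : I => ENNReal.ofReal
        (bracket (((n : ℕ) : ℝ) - ((m : ℕ) : ℝ)) ^ 1 * ‖(P n).comp (V.comp (P m))‖))
        ⟨n, hn⟩ ⟨m, hm⟩).trans hVg
      rw [ENNReal.ofReal_le_ofReal_iff (by positivity), pow_one,
        ← extend_coe P ⟨n, hn⟩, ← extend_coe P ⟨m, hm⟩] at h1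
      have h2 : (extend P n).comp (V.comp (extend P m)) = extend P n * V * extend P m := rfl
      simp only [h2] at h1
      have h3 := abs_rank_sub_le (I := I) n m
      push_cast
      rw [sub_sub_sub_cancel_right, mul_one_div, le_div_iff₀ (by positivity), mul_comm]
      refine le_trans (mul_le_mul_of_nonneg_right ?_ (norm_nonneg _)) h1
      exact max_le_max le_rfl h3
    · rw [extend_of_notMem P hm, mul_zero, norm_zero]; positivity
  · rw [extend_of_notMem P hn, zero_mul, zero_mul, norm_zero]; positivity

variable [CompleteSpace E]

/-- In the gap at a cut `k` there is a point whose distance to the bands on either side grows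
at least linearly with the rank. -/
theorem IsOfClass.exists_gap_point {g : ℝ} {H : E →ₗ.[ℂ] E} {I : Set ℕ} {P : I → E →L[ℂ] E}
    (hH : IsOfClass g H P) {k : ℕ} (h1 : ∃ n : I, (n : ℕ) < k) (h2 : ∃ n : I, k ≤ (n : ℕ)) :
    ∃ μ : ℝ, ∀ n : I,
      (k ≤ (n : ℕ) → ∃ β ∈ lowerBounds (band H (P n)),
        μ + g * ((rank I n : ℝ) - rank I k + 1 / 2) ≤ β) ∧
      ((n : ℕ) < k → ∃ α ∈ upperBounds (band H (P n)),
        α ≤ μ + g * ((rank I n : ℝ) - rank I k + 1 / 2)) := by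
  obtain ⟨n₀, m₀, hcov, hn₀, hm₀⟩ := exists_covBy_of_cut h1 h2
  obtain ⟨a, b, ha, hb, hab⟩ := hH.gap n₀ m₀ hcov
  have hrk : (rank I k : ℝ) = rank I n₀ + 1 := by
    exact_mod_cast rank_of_covBy hcov hn₀ hm₀
  have hrm : (rank I m₀ : ℝ) = rank I n₀ + 1 := by
    exact_mod_cast rank_of_covBy hcov (show (n₀ : ℕ) < m₀ from hcov.1) le_rfl
  -- One rank upwards raises the lower edge by at least `g`: the minimum of a band does not exceed
  -- its maximum, and the next gap adds `g`. The offset `1/2` comes from the midpoint of the gap at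
  -- the cut.
  have hup (N : ℕ) : ∀ n : I, (n : ℕ) ≤ N → m₀ ≤ n → ∃ β, IsLeast (band H (P n)) β ∧
      (a + b) / 2 + g * ((rank I n : ℝ) - rank I k + 1 / 2) ≤ β := by
    induction N with
    | zero =>
      intro n hn hmn
      have h3 : (n₀ : ℕ) < m₀ := hcov.1
      have h4 : (m₀ : ℕ) ≤ n := hmn
      lia
    | succ N ih =>
      intro n hn hmn
      rcases eq_or_lt_of_le hmn with rfl | hlt
      · exact ⟨b, hb, by rw [hrk, hrm]; linarith⟩
      · obtain ⟨j, l, hjl, hj, hl⟩ := exists_covBy_of_cut (k := n) ⟨m₀, hlt⟩ ⟨n, le_rfl⟩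
        obtain rfl : l = n := le_antisymm (le_of_covBy_of_lt hjl (show j < n from hj)) hl
        obtain ⟨β, hβ, hβ'⟩ := ih j (by lia)
          (not_lt.1 fun h => absurd (le_of_covBy_of_lt hjl h) (not_le.2 hlt))
        obtain ⟨a', b', ha', hb', hab'⟩ := hH.gap j l hjl
        have hr : (rank I l : ℝ) = rank I j + 1 := by
          exact_mod_cast rank_of_covBy hjl (show (j : ℕ) < l from hjl.1) le_rfl
        refine ⟨b', hb', ?_⟩
        have := ha'.2 hβ.1
        rw [hr]
        linarith
  have hdown (N : ℕ) : ∀ n : I, (n₀ : ℕ) - n ≤ N → n ≤ n₀ → ∃ α, IsGreatest (band H (P n)) α ∧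
      α ≤ (a + b) / 2 + g * ((rank I n : ℝ) - rank I k + 1 / 2) := by
    induction N with
    | zero =>
      intro n hn hmn
      obtain rfl : n = n₀ := le_antisymm hmn (show (n₀ : ℕ) ≤ n by lia)
      exact ⟨a, ha, by rw [hrk]; linarith⟩
    | succ N ih =>
      intro n hn hmn
      rcases eq_or_lt_of_le hmn with rfl | hlt
      · exact ⟨a, ha, by rw [hrk]; linarith⟩
      · obtain ⟨j, l, hjl, hj, hl⟩ := exists_covBy_of_cut (k := n + 1) ⟨n, Nat.lt_succ_self _⟩
          ⟨n₀, hlt⟩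
        obtain rfl : j = n := le_antisymm (Nat.lt_succ_iff.1 hj) (not_lt.1 fun h =>
          absurd (le_of_covBy_of_lt hjl h) (not_le.2 (show (n : ℕ) < l from hl)))
        obtain ⟨α, hα, hα'⟩ := ih l (by lia) (le_of_covBy_of_lt hjl hlt)
        obtain ⟨a', b', ha', hb', hab'⟩ := hH.gap j l hjl
        have hr : (rank I l : ℝ) = rank I j + 1 := by
          exact_mod_cast rank_of_covBy hjl (show (j : ℕ) < l from hjl.1) le_rfl
        refine ⟨a', ha', ?_⟩
        have := hα.2 hb'.1
        rw [hr] at hα'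
        linarith
  refine ⟨(a + b) / 2, fun n => ⟨fun hn => ?_, fun hn => ?_⟩⟩
  · obtain ⟨β, hβ, h⟩ := hup n n le_rfl
      (le_of_covBy_of_lt hcov (show (n₀ : ℕ) < n by lia))
    exact ⟨β, hβ.2, h⟩
  · obtain ⟨α, hα, h⟩ := hdown _ n le_rfl (not_lt.1 fun h => by
      have : (m₀ : ℕ) ≤ n := le_of_covBy_of_lt hcov h
      lia)
    exact ⟨α, hα.2, h⟩

theorem IsOfClass.isResolution {g : ℝ} {H : E →ₗ.[ℂ] E} {I : Set ℕ} {P : I → E →L[ℂ] E}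
    (hH : IsOfClass g H P) : IsResolution (extend P) := by
  refine ⟨fun n => ?_, fun n m hnm => ?_, fun x => ?_⟩
  · by_cases hn : n ∈ I
    · exact extend_coe P ⟨n, hn⟩ ▸ hH.projection _
    · rw [extend_of_notMem P hn]; exact .zero _
  · by_cases hn : n ∈ I
    · by_cases hm : m ∈ I
      · have := hH.disjoint ⟨n, hn⟩ ⟨m, hm⟩ (fun h => hnm (congrArg Subtype.val h))
        rw [← extend_coe P ⟨n, hn⟩, ← extend_coe P ⟨m, hm⟩] at this
        exact this
      · rw [extend_of_notMem P hm, mul_zero]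
    · rw [extend_of_notMem P hn, zero_mul]
  · have h := hH.complete x
    have h' : HasSum ((fun n => extend P n x) ∘ ((↑) : I → ℕ)) x := by
      have e : (fun n : I => P n x) = (fun n => extend P n x) ∘ ((↑) : I → ℕ) := by
        funext n
        rw [Function.comp_apply, extend_coe]
      rwa [e] at h
    rw [Subtype.val_injective.hasSum_iff fun n hn => ?_] at h'
    · exact h'.tendsto_sum_nat
    · rw [extend_of_notMem P (by simpa using hn)]; rfl

theorem IsOfClass.preservesGraph {g : ℝ} {H : E →ₗ.[ℂ] E} {I : Set ℕ} {P : I → E →L[ℂ] E}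
    (hH : IsOfClass g H P) (n : ℕ) : PreservesGraph H.graph (extend P n) := by
  by_cases hn : n ∈ I
  · exact extend_coe P ⟨n, hn⟩ ▸ preservesGraph_of_commutes (hH.commutes _)
  · rw [extend_of_notMem P hn]
    exact fun _ _ _ => H.graph.zero_mem

/-- At every cut `k` there is a spectral projection of `H + V` close to `∑_{n < k} Pₙ`. -/
theorem IsOfClass.exists_cut {g : ℝ} {H : E →ₗ.[ℂ] E} {I : Set ℕ} {P : I → E →L[ℂ] E}
    (hH : IsOfClass g H P) {V : E →L[ℂ] E} (hV : IsSelfAdjoint V)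
    (hVg : blockNorm P 1 V ≤ ENNReal.ofReal (g / 8)) (k : ℕ) :
    ∃ F : E →L[ℂ] E, IsStarProjection F ∧ PreservesGraph (perturb H.graph V) F ∧
      (∀ B : E →L[ℂ] E, IsSelfAdjoint B → PreservesGraph (perturb H.graph V) B → Commute F B) ∧
      ∀ x, ‖F x - partialSum (extend P) k x‖ ^ 2 ≤
        (1 - g / 32 / (g / 32 + ‖V‖)) / 2 * ‖x‖ ^ 2 := by
  have hg := hH.pos
  have hp := hH.isResolution
  have hs : 0 ≤ (1 - g / 32 / (g / 32 + ‖V‖)) / 2 := by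
    have : g / 32 / (g / 32 + ‖V‖) ≤ 1 := by
      rw [div_le_one (by positivity)]
      linarith [norm_nonneg V]
    linarith
  by_cases h1 : ∃ n : I, (n : ℕ) < k
  · by_cases h2 : ∃ n : I, k ≤ (n : ℕ)
    · obtain ⟨μ, hμ⟩ := hH.exists_gap_point h1 h2
      refine exists_spectral_cut (adjoint_graph_of_isSelfAdjoint hH.selfAdjoint)
        (fun y hy => LinearPMap.graph_fst_eq_zero_snd _ hy rfl) hV
        (hp.isStarProjection_partialSum k) (PreservesGraph.partialSum hH.preservesGraph k)
        (μ := μ) (by positivity) fun x y hxy => ?_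
      have hxy' : (x, y - V x) ∈ H.graph := hxy
      have := cut_bound hp (I := I) (fun n => extend_of_notMem P)
        -- The first block above the cut gets `c = 0` and the first below gets `c = -1`; both are at
        -- distance at least `g |2c + 1| / 2 = g/2` from `μ`.
        (c := fun n => (rank I n : ℤ) - rank I k)
        (fun a ha b hb hab => rank_injOn ha hb (by
          have : (rank I a : ℤ) - rank I k = (rank I b : ℤ) - rank I k := hab
          lia)) hg.le
        (block_norm_le hg hVg k) (k := k) (μ := μ) (x := x) (y := y - V x) (fun n => by
          by_cases hn : n ∈ I
          · obtain ⟨hlow, hhigh⟩ := hμ ⟨n, hn⟩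
            have e : extend P n = P ⟨n, hn⟩ := extend_coe P ⟨n, hn⟩
            have hPn := hH.projection ⟨n, hn⟩
            have hGn := preservesGraph_of_commutes (hH.commutes ⟨n, hn⟩)
            rw [e, map_sub, map_smul, inner_sub_right, inner_smul_right, Complex.sub_re,
              Complex.re_ofReal_mul, re_inner_self]
            push_cast
            split_ifs with hk
            · obtain ⟨α, hα, hα'⟩ := hhigh hk
              have h3 := re_inner_le_of_band hH.selfAdjoint hPn hGn hα hxy'
              have h4 : (rank I n : ℝ) + 1 ≤ rank I k := by
                have := rank_mono (I := I) (Nat.succ_le_of_lt hk)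
                rw [Nat.succ_eq_add_one, rank_succ_of_mem hn] at this
                exact_mod_cast this
              rw [abs_of_nonpos (by linarith)]
              have h5 := mul_le_mul_of_nonneg_right hα' (sq_nonneg ‖P ⟨n, hn⟩ x‖)
              simp only at h5
              linarith
            · obtain ⟨β, hβ, hβ'⟩ := hlow (not_lt.1 hk)
              have h3 := le_re_inner_of_band hH.selfAdjoint hPn hGn hβ hxy'
              have h4 : (rank I k : ℝ) ≤ rank I n := by
                exact_mod_cast rank_mono (I := I) (not_lt.1 hk)
              rw [abs_of_nonneg (by linarith)]
              have h5 := mul_le_mul_of_nonneg_right hβ' (sq_nonneg ‖P ⟨n, hn⟩ x‖)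
              simp only at h5
              linarith
          · rw [extend_of_notMem P hn]
            simp)
      rwa [sub_add_cancel] at this
    -- With no index on one side there is no gap to hold `μ`; the partial sum is then `1` or `0` and
    -- serves as `F` itself.
    · have e : partialSum (extend P) k = 1 := by
        ext x
        have h3 := hp.tendsto x
        refine tendsto_nhds_unique (tendsto_const_nhds.congr' ?_) h3
        filter_upwards [eventually_ge_atTop k] with N hN
        rw [partialSum_apply]
        refine Finset.sum_subset (Finset.range_mono hN) fun n _ hn => ?_
        rw [extend_of_notMem P fun hI => h2 ⟨⟨n, hI⟩, by simpa using hn⟩]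
        rfl
      refine ⟨1, .one _, fun x y hxy => hxy, fun B _ _ => Commute.one_left B, fun x => ?_⟩
      simpa [e] using mul_nonneg hs (sq_nonneg ‖x‖)
  · have e : partialSum (extend P) k = 0 := by
      refine Finset.sum_eq_zero fun n hn => extend_of_notMem P fun hI => h1 ⟨⟨n, hI⟩, ?_⟩
      simpa using hn
    refine ⟨0, .zero _, fun x y hxy => (perturb H.graph V).zero_mem,
      fun B _ _ => Commute.zero_left B, fun x => ?_⟩
    simpa [e] using mul_nonneg hs (sq_nonneg ‖x‖)

end Main

end BlockDiag

theorem theorem2 {E : Type*} [NormedAddCommGroup E] [InnerProductSpace ℂ E] [CompleteSpace E]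
    (g : ℝ) (H : E →ₗ.[ℂ] E) (I : Set ℕ) (P : I → E →L[ℂ] E)
    (hH : BlockDiag.IsOfClass g H P)
    (V : E →L[ℂ] E) (hV : IsSelfAdjoint V)
    (hVg : BlockDiag.blockNorm P 1 V ≤ ENNReal.ofReal (g / 8)) :
    ∃ U : E ≃ₗᵢ[ℂ] E,
      (∀ x ∈ H.domain, U.symm x ∈ H.domain) ∧
      (BlockDiag.conj U (V.toLinearMap +ᵥ H)).domain = H.domain ∧
      ∀ n : I, BlockDiag.Commutes (BlockDiag.conj U (V.toLinearMap +ᵥ H)) (P n) := by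
  have hg := hH.pos
  choose F hF hFG hFB hclose using hH.exists_cut hV hVg
  have hs : (1 - g / 32 / (g / 32 + ‖V‖)) / 2 < 1 / 2 := by
    have : 0 < g / 32 / (g / 32 + ‖V‖) := by positivity
    linarith
  obtain ⟨q, U, hqG, hUq, hUD, hUD'⟩ := BlockDiag.exists_unitary_of_cuts
    (BlockDiag.adjoint_graph_of_isSelfAdjoint hH.selfAdjoint) hV hH.isResolution
    hH.preservesGraph hF hFG (fun k l => hFB k _ (hF l).isSelfAdjoint (hFG l)) hs hclose
  rw [← BlockDiag.graph_vadd] at hqG hUD hUD'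
  have hsymm (x : E) (hx : x ∈ H.domain) : U.symm x ∈ H.domain := by
    obtain ⟨z, hz⟩ := hUD' x (H ⟨x, hx⟩) (H.mem_graph ⟨x, hx⟩)
    have h := LinearPMap.mem_domain_of_mem_graph hz
    exact h
  refine ⟨U, hsymm, ?_, fun n x => ?_⟩
  · ext x
    refine ⟨fun hx => ?_, hsymm x⟩
    obtain ⟨z, hz⟩ := hUD _ _ (LinearPMap.mem_graph (V.toLinearMap +ᵥ H) ⟨U.symm x, hx⟩)
    rw [U.apply_symm_apply] at hz
    exact LinearPMap.mem_domain_of_mem_graph hz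
  · have hx : U.symm (x : E) ∈ (V.toLinearMap +ᵥ H).domain := x.2
    have hmem := hqG n _ _ (LinearPMap.mem_graph (V.toLinearMap +ᵥ H) ⟨_, hx⟩)
    have e : U.symm (P n x) = q n (U.symm x) := by
      rw [LinearIsometryEquiv.symm_apply_eq, hUq, U.apply_symm_apply, BlockDiag.extend_coe]
    have hdom : U.symm (P n x) ∈ (V.toLinearMap +ᵥ H).domain := by
      rw [e]; exact LinearPMap.mem_domain_of_mem_graph hmem
    refine ⟨hdom, ?_⟩
    -- Since `q n` commutes with `H + V` and `U⁻¹ P_n = q_n U⁻¹`, single-valuedness of the graph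
    -- identifies the two values.
    have hval : (V.toLinearMap +ᵥ H) ⟨U.symm (P n x), hdom⟩ =
        q n ((V.toLinearMap +ᵥ H) ⟨U.symm x, hx⟩) := by
      refine LinearPMap.mem_graph_snd_inj _ (LinearPMap.mem_graph _ _) hmem e
    change U ((V.toLinearMap +ᵥ H) ⟨U.symm (P n x), hdom⟩) =
      P n (U ((V.toLinearMap +ᵥ H) ⟨U.symm x, hx⟩))
    rw [hval, hUq, BlockDiag.extend_coe]
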